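/- A labeling scheme for reachability in directed graphs consists of an encoder and a decoder. For every $n$ and every directed graph $G=(V,E)$ on $n$ nodes, the encoder assigns distinct binary strings (labels) $\ell_G(u)\in\{0,1\}^*$ to the nodes $u\in V$. The decoder is given only $\ell_G(u)$ and $\ell_G(v)$ for two nodes $u,v$ of the same (unknown) graph $G$, and has to decide whether there is a directed path, possibly of length zero, from $u$ to $v$ in $G$. The decoder is uniform: it is one fixed Word RAM program for all $n$. On a Word RAM with word length $w$ (which the program can read), each of the two labels is given as an array whose $i$-th entry holds the $i$-th block of $w$ consecutive bits of the label, padded with zeros; a unit-cost instruction reads an entry of such an array, accesses a cell of the working memory, performs an arithmetic ($+,-,\cdot,\lfloor x/y\rfloor,\bmod$), bitwise or shift operation on words, or performs a jump, possibly conditional on a comparison of two words. **Theorem.** There exist a reachability labeling scheme for all directed graphs, constants $c,T\in\mathbb N$, and a function $\varepsilon:\mathbb N\to\mathbb R$ with $\varepsilon(n)=o(n)$ such that: 1. for every $n$, every directed graph $G$ on $n$ nodes and every node $u$ of $G$, $|\ell_G(u)|\le \frac n3+\varepsilon(n)$; 2. for every $n$, every directed graph $G$ on $n$ nodes, all nodes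 $u,v$ of $G$, and every word length $w\ge c(\lfloor\log_2 n\rfloor+1)$ (in particular for word lengths $w=\Theta(\log n)$ with a large enough constant), the decoder, given $\ell_G(u)$ and $\ell_G(v)$, halts after at most $T$ steps and correctly answers whether $u$ reaches $v$ in $G$. -/

import Mathlib

open Filter Asymptotics

namespace WordRAM

/-- The two-operand word operations of the Word RAM, each executed in unit time. -/
inductive BinOp where
  | add | sub | mul | div | mod | and | or | xor | shl | shr

/-- Words are bit vectors of length `w`; arithmetic is unsigned and modulo `2 ^ w`. -/
def BinOp.eval {w : ℕ} : BinOp → BitVec w → BitVec w → BitVec w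
  | .add, x, y => x + y
  | .sub, x, y => x - y
  | .mul, x, y => x * y
  | .div, x, y => x / y
  | .mod, x, y => x % y
  | .and, x, y => x &&& y
  | .or, x, y => x ||| y
  | .xor, x, y => x ^^^ y
  | .shl, x, y => x <<< y.toNat
  | .shr, x, y => x >>> y.toNat

/-- The two read-only input arrays: the label of the source and the label of the target. -/
inductive Input where
  | source | target

/-- Instructions of the Word RAM. Registers are named by natural numbers; a program mentions only
finitely many of them. None of the instructions depends on the word length. -/
inductive Instr where
  /-- `r[d] := k mod 2 ^ w` -/
  | const (d k : ℕ)
  /-- `r[d] := r[a] op r[b]` -/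
  | bin (op : BinOp) (d a b : ℕ)
  /-- `r[d] :=` bitwise complement of `r[a]` -/
  | not (d a : ℕ)
  /-- `r[d] := M[r[a]]`, where `M` is the working memory -/
  | load (d a : ℕ)
  /-- `M[r[a]] := r[b]` -/
  | store (a b : ℕ)
  /-- `r[d] := X[r[a]]`, where `X` is one of the two input arrays -/
  | read (X : Input) (d a : ℕ)
  /-- go to instruction number `t` -/
  | jump (t : ℕ)
  /-- go to instruction number `t` if `r[a] = r[b]` -/
  | jumpEq (a b t : ℕ)
  /-- go to instruction number `t` if `r[a] < r[b]` (unsigned) -/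
  | jumpLt (a b t : ℕ)

/-- A program is a finite list of instructions; it halts when the program counter leaves it. -/
abbrev Program := List Instr

/-- Configuration of a Word RAM with word length `w`: program counter, registers, and a working
memory whose cells are addressed by words. -/
structure State (w : ℕ) where
  pc : ℕ
  reg : ℕ → BitVec w
  mem : BitVec w → BitVec w

/-- A bit string stored as an array of words of length `w`: entry `i` holds the `w` consecutive bits
number `w * i, …, w * i + w - 1`, the first one being the least significant; positions behind the
end of the string hold `0`. -/
def packed (w : ℕ) (s : List Bool) (i : ℕ) : BitVec w :=
  BitVec.ofFnLE fun j : Fin w => s.getD (w * i + j) false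

/-- The effect of one instruction, for the input strings `x` (source) and `y` (target). -/
def Instr.exec {w : ℕ} (x y : List Bool) (s : State w) : Instr → State w
  | .const d k => { s with pc := s.pc + 1, reg := Function.update s.reg d (BitVec.ofNat w k) }
  | .bin op d a b =>
      { s with pc := s.pc + 1, reg := Function.update s.reg d (op.eval (s.reg a) (s.reg b)) }
  | .not d a => { s with pc := s.pc + 1, reg := Function.update s.reg d (~~~ s.reg a) }
  | .load d a => { s with pc := s.pc + 1, reg := Function.update s.reg d (s.mem (s.reg a)) }
  | .store a b => { s with pc := s.pc + 1, mem := Function.update s.mem (s.reg a) (s.reg b) }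
  | .read .source d a =>
      { s with pc := s.pc + 1, reg := Function.update s.reg d (packed w x (s.reg a).toNat) }
  | .read .target d a =>
      { s with pc := s.pc + 1, reg := Function.update s.reg d (packed w y (s.reg a).toNat) }
  | .jump t => { s with pc := t }
  | .jumpEq a b t => { s with pc := if s.reg a = s.reg b then t else s.pc + 1 }
  | .jumpLt a b t => { s with pc := if s.reg a < s.reg b then t else s.pc + 1 }

/-- One time step; a halted configuration does not change any more. -/
def step {w : ℕ} (P : Program) (x y : List Bool) (s : State w) : State w :=
  match P[s.pc]? with
  | none => s
  | some i => i.exec x y s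

/-- At the start register `0` holds the word length; everything else is `0`. -/
def initial (w : ℕ) : State w where
  pc := 0
  reg := Function.update (fun _ => 0) 0 (BitVec.ofNat w w)
  mem := fun _ => 0

/-- With word length `w` and inputs `x`, `y`, the program `P` halts after at most `T` steps and
register `0` then holds `1` if the proposition `A` is true and `0` if it is false. -/
def DecidesWithin (P : Program) (w : ℕ) (x y : List Bool) (T : ℕ) (A : Prop) : Prop :=
  let s := (step P x y)^[T] (initial w)
  P[s.pc]? = none ∧ (A → s.reg 0 = 1) ∧ (¬ A → s.reg 0 = 0)

end WordRAM

/-- `v` is reachable from `u`: there is a directed path, possibly of length zero, from `u` to `v`. -/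
def Digraph.Reaches {V : Type*} (G : Digraph V) (u v : V) : Prop :=
  Relation.ReflTransGen G.Adj u v

/-- The encoder of a labeling scheme assigns a bit string to each node of each directed graph on `n`
nodes, for every `n`. -/
abbrev LabelEncoder := (n : ℕ) → Digraph (Fin n) → Fin n → List Bool

/-- `enc` and `dec` form a reachability labeling scheme whose decoder runs in at most `T` steps on
every Word RAM with word length at least `c * (⌊log₂ n⌋ + 1)`. The labels of the nodes of a graph are
distinct. The decoder is a single program for all `n`; all that it is given are the word length and
the labels of the two nodes, as arrays of words. -/
def IsReachabilityScheme (enc : LabelEncoder) (dec : WordRAM.Program) (c T : ℕ) : Prop :=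
  ∀ (n : ℕ) (G : Digraph (Fin n)), Function.Injective (enc n G) ∧
    ∀ w : ℕ, c * (Nat.log 2 n + 1) ≤ w → ∀ u v : Fin n,
      WordRAM.DecidesWithin dec w (enc n G u) (enc n G v) T (G.Reaches u v)

/-! Heights (numbers of ancestors) orient a comparable pair (`Digraph.reaches_iff`), so besides a
height of O(log n) bits only the symmetric comparability relation has to be encoded. Storing every
pair once costs about n/2 bits per node; transitivity brings this down to n/3.

Sort the nodes by height and cut the order into levels of o(n) nodes. Suppose that the top two
levels contain sets A (upper) and B (lower) of q nodes each with B entirely below A. A node under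
the lower level that is below some element of B is below all of A; otherwise it is comparable with
nothing in B. A node on one of the two levels shares it with A or with B, and comparable pairs
inside a level, original or merged, are stored as exceptions. So each remaining node is uniform to
one half of A ∪ B, which is split off as a group of 2q nodes. When no such pair is left, a
Kővári–Sós–Turán count (`exists_degree_lt_of_forall_not_biclique`) yields an orientation with small
out-degrees between the two levels. The out-neighbours become exceptions and the levels are merged
(`exists_isHalving`, `exists_isNumbering`).

For two groups, each node of the later one now needs only q bits, namely those for the non-uniform
half. Either the later nodes hold q bits each, or the earlier nodes hold 2q bits each. The later
nodes do so if the sum of the group numbers is 0 or 1 modulo 3, the earlier ones if it is 2. Over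
three consecutive groups every residue occurs once, so a node spends q + q bits on an earlier triple
and 2q on a later one: 2q bits per 6q nodes, that is n/3, plus 12 control bits per triple,
negligible since q tends to infinity (`lookupVal_pos_iff`).

Exceptions are kept in a bitmap with pointers to its nonempty blocks. With field width p of order
log n, levels of about n/p³ nodes and degree bound about n/p⁶, everything but the table costs o(n)
bits (`labelLength_le`). All addresses are arithmetic expressions, so the decoder is one jump-free
expression and its time is the length of its code. -/

namespace WordRAM

/-! ### Compiling expressions to jump-free code -/

/-- Word-valued expressions over the inputs of a Word RAM. -/
inductive Expr where
  | const (k : ℕ)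
  | wlen
  | bin (op : BinOp) (a b : Expr)
  | read (X : Input) (a : Expr)

/-- The input string named by an `Input`. -/
def Input.string (x y : List Bool) : Input → List Bool
  | .source => x
  | .target => y

/-- The value of an expression on a Word RAM with word length `w`. -/
def Expr.eval (w : ℕ) (x y : List Bool) : Expr → BitVec w
  | .const k => BitVec.ofNat w k
  | .wlen => BitVec.ofNat w w
  | .bin op a b => op.eval (a.eval w x y) (b.eval w x y)
  | .read X a => packed w (X.string x y) (a.eval w x y).toNat

/-- Straight-line code that computes an expression in register `d`, using only registers from
`d` on as work space and expecting the word length in register `0`. -/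
def Expr.compile : Expr → ℕ → Program
  | .const k, d => [.const d k]
  | .wlen, d => [.bin .or d 0 0]
  | .bin op a b, d => a.compile d ++ b.compile (d + 1) ++ [.bin op d d (d + 1)]
  | .read X a, d => a.compile d ++ [.read X d d]

/-- A sequence of instructions without jumps: each of them moves on to the next one. -/
def Straight (L : Program) : Prop :=
  ∀ i ∈ L, ∀ (w : ℕ) (x y : List Bool) (s : State w), (i.exec x y s).pc = s.pc + 1

theorem Straight.append {L M : Program} (hL : Straight L) (hM : Straight M) :
    Straight (L ++ M) := by
  intro i hi
  rcases List.mem_append.1 hi with h | h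
  · exact hL i h
  · exact hM i h

theorem Expr.straight_compile (e : Expr) (d : ℕ) : Straight (e.compile d) := by
  induction e generalizing d with
  | const k => simp [Straight, compile, Instr.exec]
  | wlen => simp [Straight, compile, Instr.exec]
  | bin op a b iha ihb =>
    exact ((iha d).append (ihb (d + 1))).append (by simp [Straight, Instr.exec])
  | read X a iha =>
    exact (iha d).append (by cases X <;> simp [Straight, Instr.exec])

/-- The effect of executing the instructions of a list one after the other. -/
def Program.run {w : ℕ} (x y : List Bool) (L : Program) (s : State w) : State w :=
  L.foldl (fun s i => i.exec x y s) s

theorem Program.run_append {w : ℕ} (x y : List Bool) (L M : Program) (s : State w) :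
    Program.run x y (L ++ M) s = Program.run x y M (Program.run x y L s) :=
  List.foldl_append

theorem Program.run_singleton {w : ℕ} (x y : List Bool) (i : Instr) (s : State w) :
    Program.run x y [i] s = i.exec x y s := rfl

/-- No instruction of the block jumps, so the program counter walks through it whatever surrounds
it. The context is part of the statement because the induction moves executed instructions into
`pre`. -/
theorem iterate_step_straight {w : ℕ} {x y : List Bool} {L : Program} (hL : Straight L)
    (pre post : Program) (s : State w) (hs : s.pc = pre.length) :
    (step (pre ++ L ++ post) x y)^[L.length] s = L.run x y s ∧
      (L.run x y s).pc = pre.length + L.length := by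
  induction L generalizing pre s with
  | nil => simp [hs, Program.run]
  | cons i L ih =>
    have h1 : step (pre ++ (i :: L) ++ post) x y s = i.exec x y s := by
      simp [step, hs]
    have hL' : Straight L := fun j hj => hL j (List.mem_cons_of_mem _ hj)
    have hpc : (i.exec x y s).pc = (pre ++ [i]).length := by
      rw [hL i List.mem_cons_self, hs]; simp
    have := ih hL' (pre ++ [i]) (i.exec x y s) hpc
    have h3 : Program.run x y (i :: L) s = Program.run x y L (i.exec x y s) := rfl
    simp only [List.length_cons, Function.iterate_succ, Function.comp_apply, h1, h3]
    refine ⟨?_, ?_⟩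
    · have h2 := this.1
      simpa using h2
    · rw [this.2]; simp; omega

/-- Registers serve as a stack. The second conjunct protects the left operand while the right one is
computed, and register `0`, where `wlen` is read. -/
theorem Expr.run_compile {w : ℕ} (x y : List Bool) (e : Expr) (d : ℕ) (hd : 0 < d) (s : State w)
    (hs : s.reg 0 = BitVec.ofNat w w) :
    ((e.compile d).run x y s).reg d = e.eval w x y ∧
      ∀ r < d, ((e.compile d).run x y s).reg r = s.reg r := by
  induction e generalizing d s with
  | const k =>
    refine ⟨by simp [compile, Program.run_singleton, Instr.exec, eval], fun r hr => ?_⟩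
    simp [compile, Program.run_singleton, Instr.exec, Function.update_of_ne hr.ne]
  | wlen =>
    refine ⟨by simp [compile, Program.run_singleton, Instr.exec, eval, BinOp.eval, hs],
      fun r hr => ?_⟩
    simp [compile, Program.run_singleton, Instr.exec, Function.update_of_ne hr.ne]
  | bin op a b iha ihb =>
    obtain ⟨ha, ha'⟩ := iha d hd s hs
    obtain ⟨hb, hb'⟩ := ihb (d + 1) (by omega) _ ((ha' 0 hd).trans hs)
    simp only [compile, Program.run_append, Program.run_singleton, Instr.exec]
    refine ⟨?_, fun r hr => ?_⟩
    · rw [Function.update_self, hb, hb' d (by omega), ha]; rfl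
    · rw [Function.update_of_ne hr.ne, hb' r (by omega), ha' r hr]
  | read X a iha =>
    obtain ⟨ha, ha'⟩ := iha d hd s hs
    simp only [compile, Program.run_append, Program.run_singleton]
    cases X <;>
    · simp only [Instr.exec]
      refine ⟨?_, fun r hr => ?_⟩
      · rw [Function.update_self, ha]; rfl
      · rw [Function.update_of_ne hr.ne, ha' r hr]

/-- The program that computes an expression and puts its value into register `0`. -/
def Expr.program (e : Expr) : Program := e.compile 1 ++ [.bin .or 0 1 1]

theorem Expr.decidesWithin_program (e : Expr) {w : ℕ} {x y : List Bool} {A : Prop}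
    (h1 : A → e.eval w x y = 1) (h0 : ¬ A → e.eval w x y = 0) :
    DecidesWithin e.program w x y e.program.length A := by
  have hst : Straight e.program :=
    (e.straight_compile 1).append (by simp [Straight, Instr.exec])
  have hrun := iterate_step_straight (x := x) (y := y) hst [] [] (initial w) rfl
  simp only [List.nil_append, List.append_nil, List.length_nil, zero_add] at hrun
  have hreg : (e.program.run x y (initial w)).reg 0 = e.eval w x y := by
    have := (e.run_compile x y 1 one_pos (initial w) (by simp [initial])).1
    rw [program, Program.run_append, Program.run_singleton]
    simp [Instr.exec, BinOp.eval, this]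
  refine ⟨?_, ?_, ?_⟩
  · rw [hrun.1, hrun.2]; simp
  · rw [hrun.1, hreg]; exact h1
  · rw [hrun.1, hreg]; exact h0

end WordRAM

/-! ### Word arithmetic: indicators, unaligned reads, lowest set bit -/

namespace WordRAM

theorem getLsbD_packed (w : ℕ) (s : List Bool) (i j : ℕ) :
    (packed w s i).getLsbD j = (decide (j < w) && s.getD (w * i + j) false) := by
  by_cases h : j < w
  · simp [packed, h]
  · rw [BitVec.getLsbD_of_ge _ _ (not_lt.1 h)]
    simp [h]

/-- The expression `e` evaluates to the residue of `a` modulo `2 ^ w`. -/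
def Expr.Val (w : ℕ) (x y : List Bool) (e : Expr) (a : ℕ) : Prop :=
  e.eval w x y = BitVec.ofNat w a

namespace Expr

variable {w : ℕ} {x y : List Bool} {e f : Expr} {a b : ℕ}

theorem val_const (k : ℕ) : (const k).Val w x y k := rfl

theorem val_wlen : wlen.Val w x y w := rfl

theorem Val.add (he : e.Val w x y a) (hf : f.Val w x y b) : (bin .add e f).Val w x y (a + b) := by
  unfold Val at *
  simp [eval, BinOp.eval, he, hf, BitVec.ofNat_add]

theorem Val.mul (he : e.Val w x y a) (hf : f.Val w x y b) : (bin .mul e f).Val w x y (a * b) := by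
  unfold Val at *
  simp [eval, BinOp.eval, he, hf, BitVec.ofNat_mul]

theorem Val.sub (he : e.Val w x y a) (hf : f.Val w x y b) (hba : b ≤ a) :
    (bin .sub e f).Val w x y (a - b) := by
  unfold Val at *
  obtain ⟨c, rfl⟩ := Nat.exists_eq_add_of_le hba
  simp only [eval, BinOp.eval, he, hf, BitVec.ofNat_add]
  rw [Nat.add_sub_cancel_left, add_comm, BitVec.add_sub_cancel]

/-- Sums and products respect residues modulo `2 ^ w`, quotients and remainders do not; hence the
size bounds. -/
theorem Val.div (he : e.Val w x y a) (hf : f.Val w x y b) (ha : a < 2 ^ w) (hb : b < 2 ^ w) :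
    (bin .div e f).Val w x y (a / b) := by
  unfold Val at *
  apply BitVec.eq_of_toNat_eq
  simp [eval, BinOp.eval, he, hf, Nat.mod_eq_of_lt ha, Nat.mod_eq_of_lt hb,
    Nat.mod_eq_of_lt ((Nat.div_le_self a b).trans_lt ha)]

theorem Val.mod (he : e.Val w x y a) (hf : f.Val w x y b) (ha : a < 2 ^ w) (hb : b < 2 ^ w) :
    (bin .mod e f).Val w x y (a % b) := by
  unfold Val at *
  apply BitVec.eq_of_toNat_eq
  simp [eval, BinOp.eval, he, hf, Nat.mod_eq_of_lt ha, Nat.mod_eq_of_lt hb,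
    Nat.mod_eq_of_lt ((Nat.mod_le a b).trans_lt ha)]

/-- Indicator of a nonzero value. -/
def nz (e : Expr) : Expr := bin .div e e

/-- Indicator of the inequality of two values. -/
def le (e f : Expr) : Expr :=
  nz (bin .div (bin .add f (const 1)) (bin .add e (const 1)))

/-- Indicator of the strict inequality of two values. -/
def lt (e f : Expr) : Expr := le (bin .add e (const 1)) f

/-- Division by zero yields zero, so `a / a` is already the indicator. -/
theorem Val.nz (he : e.Val w x y a) (ha : a < 2 ^ w) :
    e.nz.Val w x y (if 0 < a then 1 else 0) := by
  have : e.nz.Val w x y (a / a) := he.div he ha ha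
  rcases Nat.eq_zero_or_pos a with h | h
  · simpa [h] using this
  · simpa [h, Nat.div_self h] using this

/-- The quotient `(b + 1) / (a + 1)` has a positive divisor and is nonzero exactly if `a ≤ b`.
Comparisons thus need no jumps. -/
theorem Val.le (he : e.Val w x y a) (hf : f.Val w x y b) (ha : a + 1 < 2 ^ w)
    (hb : b + 1 < 2 ^ w) : (e.le f).Val w x y (if a ≤ b then 1 else 0) := by
  have : (e.le f).Val w x y (if 0 < (b + 1) / (a + 1) then 1 else 0) :=
    ((hf.add (val_const 1)).div (he.add (val_const 1)) hb ha).nz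
      ((Nat.div_le_self _ _).trans_lt hb)
  simpa [Nat.div_pos_iff] using this

theorem Val.lt (he : e.Val w x y a) (hf : f.Val w x y b) (ha : a + 2 < 2 ^ w)
    (hb : b + 1 < 2 ^ w) : (e.lt f).Val w x y (if a < b then 1 else 0) :=
  (he.add (val_const 1)).le hf ha hb

/-- The `w` bits of an input string from position `e` on. -/
def window (X : Input) (e : Expr) : Expr :=
  bin .or (bin .shr (read X (bin .div e wlen)) (bin .mod e wlen))
    (bin .shl (read X (bin .add (bin .div e wlen) (const 1)))
      (bin .sub wlen (bin .mod e wlen)))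

/-- A run of `w` bits meets at most two consecutive words. At an aligned position the shift by `w`
clears the second word, so that case needs no separate code. -/
theorem Val.getLsbD_window (X : Input) (he : e.Val w x y a) (ha : a + 1 < 2 ^ w) {j : ℕ}
    (hj : j < w) :
    ((window X e).eval w x y).getLsbD j = (X.string x y).getD (a + j) false := by
  have hw : w < 2 ^ w := Nat.lt_two_pow_self
  have hw0 : 0 < w := by omega
  have ha' : a < 2 ^ w := by omega
  have hd := he.div val_wlen ha' hw
  have hm := he.mod val_wlen ha' hw
  have hs := val_wlen.sub hm (Nat.mod_lt a hw0).le
  have hd1 := hd.add (val_const (w := w) (x := x) (y := y) 1)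
  have e1 : a / w + 1 < 2 ^ w := by have := Nat.div_le_self a w; omega
  have e2 : a % w < 2 ^ w := by have := Nat.mod_le a w; omega
  have e3 : w - a % w < 2 ^ w := by omega
  have key := Nat.div_add_mod a w
  have hlt := Nat.mod_lt a hw0
  unfold Val at hd hm hs hd1
  simp only [window, eval, BinOp.eval] at *
  rw [hs, hm, hd1, hd]
  simp only [BitVec.getLsbD_or, BitVec.toNat_ofNat, Nat.mod_eq_of_lt e1,
    Nat.mod_eq_of_lt e2, Nat.mod_eq_of_lt e3, BitVec.getLsbD_ushiftRight,
    BitVec.getLsbD_shiftLeft, getLsbD_packed,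
    Nat.mod_eq_of_lt (show a / w < 2 ^ w by omega), hj, decide_true, Bool.true_and]
  by_cases h : a % w + j < w
  · have : w * (a / w) + (a % w + j) = a + j := by omega
    simp [h, this, show j < w - a % w by omega]
  · have e4 : w * (a / w + 1) + (j - (w - a % w)) = a + j := by
      rw [mul_add]; omega
    simp [h, show ¬ j < w - a % w by omega, e4, show j - (w - a % w) < w by omega]

theorem Val.field (X : Input) (he : e.Val w x y a) (ha : a + 1 < 2 ^ w) {p v : ℕ} (hpw : p < w)
    (hf : f.Val w x y (2 ^ p)) (hv : v < 2 ^ p)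
    (hbits : ∀ j < p, (X.string x y).getD (a + j) false = v.testBit j) :
    (bin .mod (window X e) f).Val w x y v := by
  have hp : 2 ^ p < 2 ^ w := Nat.pow_lt_pow_right one_lt_two hpw
  unfold Val at *
  apply BitVec.eq_of_toNat_eq
  simp only [eval, BinOp.eval, hf, BitVec.toNat_umod, BitVec.toNat_ofNat, Nat.mod_eq_of_lt hp,
    Nat.mod_eq_of_lt (hv.trans hp)]
  apply Nat.eq_of_testBit_eq
  intro j
  rw [Nat.testBit_mod_two_pow]
  by_cases hj : j < p
  · have := getLsbD_window X (e := e) (a := a) he ha (hj.trans hpw)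
    simp only [BitVec.getLsbD, hbits j hj] at this
    simp [hj, this]
  · have : v.testBit j = false :=
      Nat.testBit_lt_two_pow (hv.trans_le (Nat.pow_le_pow_right two_pos (by omega)))
    simp [hj, this]

theorem Val.bit (X : Input) (he : e.Val w x y a) (ha : a + 1 < 2 ^ w) (hw : 1 < w) :
    (bin .mod (window X e) (const 2)).Val w x y ((X.string x y).getD a false).toNat := by
  refine he.field X ha (p := 1) hw (val_const 2) (Bool.toNat_lt _) ?_
  intro j hj
  obtain rfl : j = 0 := by omega
  cases h : (X.string x y).getD a false <;> simp_all

/-- Twice the lowest set bit of a word. -/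
def lowBit (e : Expr) : Expr := bin .add (bin .xor e (bin .sub e (const 1))) (const 1)

/-- Subtracting one flips exactly the bits up to the lowest set one, so the xor is `2 ^ (p + 1) -
1`. This turns a unary prefix into a power of two without a search. -/
theorem Val.lowBit {p m : ℕ} (he : e.Val w x y (2 ^ p * (2 * m + 1))) :
    e.lowBit.Val w x y (2 ^ (p + 1)) := by
  have h0 : 1 ≤ 2 ^ p * (2 * m + 1) := Nat.one_le_iff_ne_zero.2 (by positivity)
  have hs := he.sub (val_const 1) h0
  have hxor : (2 ^ p * (2 * m + 1)) ^^^ (2 ^ p * (2 * m + 1) - 1) = 2 ^ (p + 1) - 1 := by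
    have hp : 1 ≤ 2 ^ p := Nat.one_le_two_pow
    have e1 : 2 ^ p * (2 * m + 1) = 2 ^ (p + 1) * m + 2 ^ p := by ring
    have e2 : 2 ^ (p + 1) * m + 2 ^ p - 1 = 2 ^ (p + 1) * m + (2 ^ p - 1) := by omega
    have l1 : 2 ^ p < 2 ^ (p + 1) := Nat.pow_lt_pow_right one_lt_two (by omega)
    rw [e1, e2]
    apply Nat.eq_of_testBit_eq
    intro j
    rw [Nat.testBit_xor, Nat.testBit_two_pow_mul_add _ l1,
      Nat.testBit_two_pow_mul_add _ (by omega), Nat.testBit_two_pow_sub_one]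
    by_cases hj : j < p + 1
    · simp only [hj, if_true, Nat.testBit_two_pow, Nat.testBit_two_pow_sub_one]
      by_cases hjp : p = j
      · simp [hjp]
      · simp [hjp, show j < p by omega]
    · simp [hj]
  have h1 : (bin .xor e (bin .sub e (const 1))).Val w x y (2 ^ (p + 1) - 1) := by
    unfold Val at *
    simp only [eval] at hs ⊢
    rw [hs, he, ← hxor]
    simp [BinOp.eval, BitVec.ofNat_xor]
  have := h1.add (val_const 1)
  rwa [Nat.sub_add_cancel Nat.one_le_two_pow] at this

end Expr

end WordRAM

/-! ### Sparse relations and the halving numbering -/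

namespace ReachLabel

open Classical in
/-- A symmetric relation all of whose finite restrictions have a vertex of degree at most `d` can
be oriented with out-degrees at most `d`. -/
theorem exists_orientation {V : Type*} (N : V → V → Prop) (hN : ∀ x y, N x y → N y x) (d : ℕ)
    (R : Finset V)
    (hd : ∀ W ⊆ R, W.Nonempty → ∃ x ∈ W, (W.filter (N x)).card ≤ d) :
    ∃ O : V → Finset V, (∀ x, (O x).card ≤ d) ∧ (∀ x, ∀ y ∈ O x, N x y) ∧
      ∀ x ∈ R, ∀ y ∈ R, N x y → y ∈ O x ∨ x ∈ O y := by
  induction R using Finset.strongInduction with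
  | H R ih =>
    rcases R.eq_empty_or_nonempty with rfl | hR
    · exact ⟨fun _ => ∅, by simp, by simp, by simp⟩
    obtain ⟨v, hv, hdeg⟩ := hd R subset_rfl hR
    obtain ⟨O, hO, hON, hcov⟩ := ih (R.erase v) (Finset.erase_ssubset hv)
      fun W hW => hd W (hW.trans (Finset.erase_subset _ _))
    -- The low-degree vertex `v` points to all its neighbours in `R`; pairs avoiding `v` are covered
    -- by induction.
    refine ⟨Function.update O v (R.filter (N v)), fun x => ?_, fun x y hxy => ?_,
      fun x hx y hy hxy => ?_⟩
    · by_cases hxv : x = v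
      · subst hxv; simpa using hdeg
      · simpa [hxv] using hO x
    · by_cases hxv : x = v
      · subst hxv
        rw [Function.update_self] at hxy
        exact (Finset.mem_filter.1 hxy).2
      · rw [Function.update_of_ne hxv] at hxy
        exact hON x y hxy
    · by_cases hxv : x = v
      · subst hxv; left; simpa using ⟨hy, hxy⟩
      by_cases hyv : y = v
      · subst hyv; right; simpa using ⟨hx, hN _ _ hxy⟩
      simpa [hxv, hyv] using
        hcov x (Finset.mem_erase.2 ⟨hxv, hx⟩) y (Finset.mem_erase.2 ⟨hyv, hy⟩) hxy

open Classical in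
/-- A bipartite relation without complete `q × q` part has a vertex of small degree on its larger
side. -/
theorem exists_degree_lt_of_forall_not_biclique {V : Type*} (r : V → V → Prop) {S T : Finset V}
    {q n δ : ℕ} (hδ : q * n ^ (q - 1) < δ ^ q) (hq : 1 ≤ q) (hTS : T.card ≤ S.card)
    (hTn : T.card ≤ n) (hS : S.Nonempty)
    (hfree : ∀ A ⊆ S, ∀ B ⊆ T, A.card = q → B.card = q → ¬ ∀ a ∈ A, ∀ b ∈ B, r a b) :
    ∃ s ∈ S, (T.filter (r s)).card < δ + q := by
  by_contra! hdeg
  -- Double count pairs of a vertex of `S` and a `q`-subset of its neighbourhood: without a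
  -- biclique, a `q`-subset has at most `q - 1` common neighbours.
  have hcount : S.card * (δ + q).choose q ≤ (T.powersetCard q).card * (q - 1) := by
    refine Finset.card_mul_le_card_mul (fun s Q => ∀ b ∈ Q, r s b) (fun s hs => ?_)
      (fun Q hQ => ?_)
    · calc (δ + q).choose q ≤ ((T.filter (r s)).card).choose q :=
            Nat.choose_le_choose q (hdeg s hs)
        _ = ((T.filter (r s)).powersetCard q).card := (Finset.card_powersetCard _ _).symm
        _ ≤ _ := by
          refine Finset.card_le_card fun Q hQ => ?_
          rw [Finset.mem_powersetCard] at hQ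
          rw [Finset.mem_bipartiteAbove, Finset.mem_powersetCard]
          exact ⟨⟨hQ.1.trans (Finset.filter_subset _ _), hQ.2⟩,
            fun b hb => (Finset.mem_filter.1 (hQ.1 hb)).2⟩
    · by_contra! hlt
      obtain ⟨A, hA, hAq⟩ := Finset.exists_subset_card_eq (Nat.le_of_pred_lt hlt)
      rw [Finset.mem_powersetCard] at hQ
      refine hfree A (fun a ha => ?_) Q hQ.1 hAq hQ.2 fun a ha => ?_
      · exact ((Finset.mem_bipartiteBelow _).1 (hA ha)).1
      · exact ((Finset.mem_bipartiteBelow _).1 (hA ha)).2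
  rw [Finset.card_powersetCard] at hcount
  have h1 : S.card * (δ + q).descFactorial q ≤ T.card.descFactorial q * (q - 1) := by
    rw [Nat.descFactorial_eq_factorial_mul_choose, Nat.descFactorial_eq_factorial_mul_choose]
    calc _ = q.factorial * (S.card * (δ + q).choose q) := by ring
      _ ≤ q.factorial * (T.card.choose q * (q - 1)) := Nat.mul_le_mul_left _ hcount
      _ = _ := by ring
  -- The surplus `q` in the degree keeps all factors of the falling factorial above `δ`.
  have h2 : δ ^ q ≤ (δ + q).descFactorial q :=
    (Nat.pow_le_pow_left (by omega) q).trans (Nat.pow_sub_le_descFactorial _ _)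
  have hTpos : 0 < T.card := by
    obtain ⟨s, hs⟩ := hS
    have := hdeg s hs
    have := Finset.card_filter_le T (r s)
    omega
  have h3 : T.card * δ ^ q ≤ T.card * (T.card ^ (q - 1) * (q - 1)) := by
    calc T.card * δ ^ q ≤ S.card * (δ + q).descFactorial q := Nat.mul_le_mul hTS h2
      _ ≤ T.card.descFactorial q * (q - 1) := h1
      _ ≤ T.card ^ q * (q - 1) := Nat.mul_le_mul_right _ (Nat.descFactorial_le_pow _ _)
      _ = _ := by
        obtain ⟨q, rfl⟩ := Nat.exists_eq_add_of_le' hq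
        simp only [Nat.add_sub_cancel]; ring
  have h4 := Nat.le_of_mul_le_mul_left h3 hTpos
  have h5 : T.card ^ (q - 1) * (q - 1) ≤ n ^ (q - 1) * q :=
    Nat.mul_le_mul (Nat.pow_le_pow_left hTn _) (Nat.sub_le _ _)
  rw [mul_comm] at hδ
  omega

/-- Two elements that are related by `lt` in one direction and lie on different levels of `h`. -/
def Cross {V : Type*} (lt : V → V → Prop) (h : V → ℕ) (x y : V) : Prop :=
  h x ≠ h y ∧ (lt x y ∨ lt y x)

theorem Cross.symm {V : Type*} {lt : V → V → Prop} {h : V → ℕ} {x y : V} (H : Cross lt h x y) :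
    Cross lt h y x := ⟨H.1.symm, H.2.symm⟩

open Classical in
/-- If two levels contain no complete `q × q` part then the relation between them can be oriented
with small out-degrees. -/
theorem exists_orientation_of_forall_not_biclique {V : Type*} {lt : V → V → Prop} {h : V → ℕ}
    {R : Finset V} {k q n δ : ℕ} (hδ : q * n ^ (q - 1) < δ ^ q) (hq : 1 ≤ q) (hn : R.card ≤ n)
    (hmono : ∀ x ∈ R, ∀ y ∈ R, lt x y → h x ≤ h y)
    (hfree : ∀ A ⊆ R, ∀ B ⊆ R, A.card = q → B.card = q → (∀ a ∈ A, h a = k + 1) →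
      (∀ b ∈ B, h b = k) → ¬ ∀ a ∈ A, ∀ b ∈ B, lt b a) :
    ∃ O : V → Finset V, (∀ x, (O x).card ≤ δ + q) ∧ (∀ x, ∀ y ∈ O x, Cross lt h x y) ∧
      ∀ x ∈ R, ∀ y ∈ R, k ≤ h x → h x ≤ k + 1 → k ≤ h y → h y ≤ k + 1 → Cross lt h x y →
        y ∈ O x ∨ x ∈ O y := by
  suffices H : ∀ W ⊆ R, W.Nonempty → ∃ x ∈ W, (W.filter fun y => k ≤ h x ∧ h x ≤ k + 1 ∧
      k ≤ h y ∧ h y ≤ k + 1 ∧ Cross lt h x y).card ≤ δ + q by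
    obtain ⟨O, hO, hON, hcov⟩ := exists_orientation
      (fun x y => k ≤ h x ∧ h x ≤ k + 1 ∧ k ≤ h y ∧ h y ≤ k + 1 ∧ Cross lt h x y)
      (fun x y H => ⟨H.2.2.1, H.2.2.2.1, H.1, H.2.1, H.2.2.2.2.symm⟩) (δ + q) R
      (by convert H)
    exact ⟨O, hO, fun x y hy => (hON x y hy).2.2.2.2, fun x hx y hy h1 h2 h3 h4 h5 =>
      hcov x hx y hy ⟨h1, h2, h3, h4, h5⟩⟩
  intro W hW hWne
  have hWR : W.card ≤ n := (Finset.card_le_card hW).trans hn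
  have memS : ∀ {i x}, x ∈ W.filter (fun x => h x = i) → x ∈ R ∧ h x = i := fun hx =>
    ⟨hW (Finset.mem_filter.1 hx).1, (Finset.mem_filter.1 hx).2⟩
  have hle : ∀ i, (W.filter fun x => h x = i).card ≤ n := fun i =>
    (Finset.card_filter_le _ _).trans hWR
  -- The count finds the low-degree vertex on the larger level; if `W` meets neither level, any
  -- vertex works.
  by_cases hST : (W.filter fun x => h x = k).card ≤ (W.filter fun x => h x = k + 1).card
  · rcases (W.filter fun x => h x = k + 1).eq_empty_or_nonempty with hS | hS
    · rw [hS, Finset.card_empty, Nat.le_zero, Finset.card_eq_zero] at hST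
      obtain ⟨x, hx⟩ := hWne
      refine ⟨x, hx, ?_⟩
      rw [Finset.filter_eq_empty_iff.2 fun y _ H => ?_]
      · exact Nat.zero_le _
      · have h1 := Finset.filter_eq_empty_iff.1 hS hx
        have h2 := Finset.filter_eq_empty_iff.1 hST hx
        omega
    · obtain ⟨s, hs, hdeg⟩ := exists_degree_lt_of_forall_not_biclique (fun a b => lt b a) hδ hq
        hST (hle k) hS fun A hA B hB hAq hBq =>
          hfree A (fun a ha => (memS (hA ha)).1) B (fun b hb => (memS (hB hb)).1) hAq hBq
            (fun a ha => (memS (hA ha)).2) (fun b hb => (memS (hB hb)).2)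
      refine ⟨s, (Finset.mem_filter.1 hs).1, le_trans (Finset.card_le_card ?_) hdeg.le⟩
      intro y hy
      obtain ⟨hyW, h1, h2, h3, h4, h5, h6⟩ := Finset.mem_filter.1 hy
      have hsk := (memS hs).2
      have hyk : h y = k := by omega
      refine Finset.mem_filter.2 ⟨Finset.mem_filter.2 ⟨hyW, hyk⟩, h6.resolve_left fun hlt => ?_⟩
      have := hmono _ (memS hs).1 _ (hW hyW) hlt
      omega
  · obtain ⟨s, hs, hdeg⟩ := exists_degree_lt_of_forall_not_biclique lt hδ hq
        (not_le.1 hST).le (hle (k + 1)) (Finset.card_pos.1 (by omega)) fun B hB A hA hBq hAq H =>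
          hfree A (fun a ha => (memS (hA ha)).1) B (fun b hb => (memS (hB hb)).1) hAq hBq
            (fun a ha => (memS (hA ha)).2) (fun b hb => (memS (hB hb)).2)
            fun a ha b hb => H b hb a ha
    refine ⟨s, (Finset.mem_filter.1 hs).1, le_trans (Finset.card_le_card ?_) hdeg.le⟩
    intro y hy
    obtain ⟨hyW, h1, h2, h3, h4, h5, h6⟩ := Finset.mem_filter.1 hy
    have hsk := (memS hs).2
    have hyk : h y = k + 1 := by omega
    refine Finset.mem_filter.2 ⟨Finset.mem_filter.2 ⟨hyW, hyk⟩, h6.resolve_right fun hlt => ?_⟩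
    have := hmono _ (hW hyW) _ (memS hs).1 hlt
    omega

/-- The numbers of the elements of `R` in `[0, #R)` are cut into groups of `2 * q`. Up to the pairs
stored in `F`, every element is related in the same way to all elements of one half of each earlier
group. -/
def IsHalving {V : Type*} (Q : V → V → Prop) (R : Finset V) (q d : ℕ) (num : V → ℕ)
    (F : V → Finset V) : Prop :=
  Set.InjOn num R ∧ (∀ x ∈ R, num x < R.card) ∧ (∀ x, (F x).card ≤ d) ∧
    (∀ x, ∀ y ∈ F x, Q x y) ∧
    ∀ x ∈ R, ∀ g < num x / (2 * q), ∃ (s : ℕ) (c : Prop), s < 2 ∧ ∀ y ∈ R, num y / (2 * q) = g →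
      num y % (2 * q) / q = s → y ∉ F x → x ∉ F y → (Q x y ↔ c)

-- `A` and `B` become the halves 0 and 1 of a new group 0 and the other groups move up by one. No
-- exceptions are added.
open Classical in
theorem exists_isHalving_of_biclique {V : Type*} {lt : V → V → Prop}
    (htrans : ∀ x y z, lt x y → lt y z → lt x z) {h : V → ℕ} {R A B : Finset V} {k q d : ℕ}
    (hq : 1 ≤ q) (hk : ∀ x ∈ R, h x ≤ k + 1) (hmono : ∀ x ∈ R, ∀ y ∈ R, lt x y → h x ≤ h y)
    (hAR : A ⊆ R) (hBR : B ⊆ R) (hA : A.card = q) (hB : B.card = q) (hAh : ∀ a ∈ A, h a = k + 1)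
    (hBh : ∀ b ∈ B, h b = k) (hAB : ∀ a ∈ A, ∀ b ∈ B, lt b a) {num : V → ℕ} {F : V → Finset V}
    (hrec : IsHalving (Cross lt h) (R \ (A ∪ B)) q d num F) :
    ∃ num', IsHalving (Cross lt h) R q d num' F := by
  have hdisj : ∀ x, x ∈ A → x ∉ B := fun x hxA hxB => by
    have := hAh x hxA; have := hBh x hxB; omega
  have hcard : (R \ (A ∪ B)).card + 2 * q = R.card := by
    have h1 := Finset.card_sdiff_add_card_eq_card (Finset.union_subset hAR hBR)
    rw [Finset.card_union_of_disjoint (Finset.disjoint_left.2 fun {x} => hdisj x), hA, hB] at h1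
    omega
  obtain ⟨hinj, hlt, hF, hFQ, hstr⟩ := hrec
  let eA := A.equivFinOfCardEq hA
  let eB := B.equivFinOfCardEq hB
  let num' : V → ℕ := fun x =>
    if hx : x ∈ A then eA ⟨x, hx⟩ else if hx : x ∈ B then q + eB ⟨x, hx⟩ else 2 * q + num x
  have nA : ∀ x (hx : x ∈ A), num' x = eA ⟨x, hx⟩ := fun x hx => by simp [num', hx]
  have nB : ∀ x (hx : x ∈ B), num' x = q + eB ⟨x, hx⟩ := fun x hx => by
    have hxA : x ∉ A := fun h => hdisj x h hx
    simp [num', hx, hxA]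
  have nR : ∀ x, x ∉ A → x ∉ B → num' x = 2 * q + num x := fun x hx hx' => by
    simp [num', hx, hx']
  have lA : ∀ x, x ∈ A → num' x < q := fun x hx => by rw [nA x hx]; exact (eA _).2
  have lB : ∀ x, x ∈ B → q ≤ num' x ∧ num' x < 2 * q := fun x hx => by
    rw [nB x hx]; have := (eB ⟨x, hx⟩).2; omega
  have lR : ∀ x, x ∉ A → x ∉ B → 2 * q ≤ num' x := fun x hx hx' => by rw [nR x hx hx']; omega
  have memR : ∀ x ∈ R, x ∉ A → x ∉ B → x ∈ R \ (A ∪ B) := fun x hx h1 h2 => by simp [hx, h1, h2]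
  have split : ∀ x, x ∈ A ∨ x ∈ B ∨ (x ∉ A ∧ x ∉ B) := fun x => by tauto
  have gR : ∀ x, x ∉ A → x ∉ B → num' x / (2 * q) = num x / (2 * q) + 1 := fun x h1 h2 => by
    rw [nR x h1 h2, Nat.add_div_left _ (by omega)]
  refine ⟨num', ?_, ?_, hF, hFQ, ?_⟩
  · intro x hx y hy hxy
    have cmp : ∀ z, z ∈ A ∧ num' z < q ∨ z ∈ B ∧ q ≤ num' z ∧ num' z < 2 * q ∨
        (z ∉ A ∧ z ∉ B) ∧ 2 * q ≤ num' z := fun z => by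
      rcases split z with h | h | h
      · exact Or.inl ⟨h, lA z h⟩
      · exact Or.inr (Or.inl ⟨h, lB z h⟩)
      · exact Or.inr (Or.inr ⟨h, lR z h.1 h.2⟩)
    rcases cmp x with hx' | hx' | hx' <;> rcases cmp y with hy' | hy' | hy' <;> try omega
    · rw [nA x hx'.1, nA y hy'.1] at hxy
      simpa using eA.injective (Fin.ext hxy)
    · rw [nB x hx'.1, nB y hy'.1] at hxy
      simpa using congrArg Subtype.val (eB.injective (Fin.ext (Nat.add_left_cancel hxy)))
    · rw [nR x hx'.1.1 hx'.1.2, nR y hy'.1.1 hy'.1.2] at hxy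
      exact hinj (by simpa using memR x hx hx'.1.1 hx'.1.2)
        (by simpa using memR y hy hy'.1.1 hy'.1.2) (by omega)
  · intro x hx
    rcases split x with h | h | h
    · have := lA x h; omega
    · have := lB x h; omega
    · have := hlt x (memR x hx h.1 h.2)
      rw [nR x h.1 h.2]; omega
  · intro x hx g hg
    obtain ⟨hxA, hxB⟩ : x ∉ A ∧ x ∉ B := by
      rcases split x with h | h | h
      · rw [Nat.div_eq_of_lt (by have := lA x h; omega)] at hg; omega
      · rw [Nat.div_eq_of_lt (lB x h).2] at hg; omega
      · exact h
    rw [gR x hxA hxB] at hg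
    have hxR := memR x hx hxA hxB
    rcases g with _ | g
    · have inA : ∀ y, num' y / (2 * q) = 0 → num' y % (2 * q) / q = 0 → y ∈ A := by
        intro y h1 h2
        have h3 : num' y < 2 * q := (Nat.div_eq_zero_iff.1 h1).resolve_left (by omega)
        rw [Nat.mod_eq_of_lt h3] at h2
        have h4 : num' y < q := (Nat.div_eq_zero_iff.1 h2).resolve_left (by omega)
        rcases split y with h | h | h
        · exact h
        · have := lB y h; omega
        · have := lR y h.1 h.2; omega
      have inB : ∀ y, num' y / (2 * q) = 0 → num' y % (2 * q) / q = 1 → y ∈ B := by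
        intro y h1 h2
        have h3 : num' y < 2 * q := (Nat.div_eq_zero_iff.1 h1).resolve_left (by omega)
        rcases split y with h | h | h
        · rw [Nat.mod_eq_of_lt h3, Nat.div_eq_of_lt (lA y h)] at h2; omega
        · exact h
        · have := lR y h.1 h.2; omega
      have hxk := hk x hx
      -- Below both levels transitivity decides between `A` and `B`, and monotonicity excludes `b <
      -- x`. On level `k` there are no cross pairs with `B`, on level `k + 1` none with `A`.
      rcases Nat.lt_or_ge (h x) k with hlow | hhigh
      · by_cases hex : ∃ b ∈ B, lt x b
        · obtain ⟨b, hb, hxb⟩ := hex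
          refine ⟨0, True, by norm_num, fun y _ h1 h2 _ _ => iff_true_intro ?_⟩
          have hy := inA y h1 h2
          exact ⟨by rw [hAh y hy]; omega, Or.inl (htrans _ _ _ hxb (hAB y hy b hb))⟩
        · refine ⟨1, False, by norm_num, fun y hyR h1 h2 _ _ => iff_false_intro ?_⟩
          have hy := inB y h1 h2
          rintro ⟨-, H | H⟩
          · exact hex ⟨y, hy, H⟩
          · have := hmono y hyR x hx H
            rw [hBh y hy] at this; omega
      · rcases eq_or_lt_of_le hhigh with heq | hgt
        · exact ⟨1, False, by norm_num, fun y _ h1 h2 _ _ => iff_false_intro fun H =>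
            H.1 (by rw [hBh y (inB y h1 h2)]; omega)⟩
        · exact ⟨0, False, by norm_num, fun y _ h1 h2 _ _ => iff_false_intro fun H =>
            H.1 (by rw [hAh y (inA y h1 h2)]; omega)⟩
    · obtain ⟨s, c, hs2, hsc⟩ := hstr x hxR g (by omega)
      refine ⟨s, c, hs2, fun y hyR h1 h2 => ?_⟩
      obtain ⟨hyA, hyB⟩ : y ∉ A ∧ y ∉ B := by
        rcases split y with h | h | h
        · rw [Nat.div_eq_of_lt (by have := lA y h; omega)] at h1; omega
        · rw [Nat.div_eq_of_lt (lB y h).2] at h1; omega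
        · exact h
      rw [gR y hyA hyB] at h1
      rw [nR y hyA hyB, Nat.add_mod_left] at h2
      exact hsc y (memR y hyR hyA hyB) (by omega) h2

-- The outer induction is on the number of levels, the inner one on `R`. Bicliques between the top
-- two levels are split off for free; each merge of two biclique-free levels costs `δ + q`
-- exceptions per node.
open Classical in
theorem exists_isHalving {V : Type*} {lt : V → V → Prop}
    (htrans : ∀ x y z, lt x y → lt y z → lt x z) {q n δ : ℕ} (hδ : q * n ^ (q - 1) < δ ^ q)
    (hq : 1 ≤ q) (k : ℕ) (h : V → ℕ) (R : Finset V) (hn : R.card ≤ n) (hk : ∀ x ∈ R, h x ≤ k)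
    (hmono : ∀ x ∈ R, ∀ y ∈ R, lt x y → h x ≤ h y) :
    ∃ num F, IsHalving (Cross lt h) R q (k * (δ + q)) num F := by
  induction k generalizing h R with
  | zero =>
    let e := R.equivFin
    refine ⟨fun x => if hx : x ∈ R then e ⟨x, hx⟩ else 0, fun _ => ∅, ?_, ?_, by simp, by simp, ?_⟩
    · intro x hx y hy hxy
      simp only [Finset.mem_coe] at hx hy
      simp only [hx, hy, dite_true] at hxy
      simpa using e.injective (Fin.ext hxy)
    · intro x hx
      simp [hx]
    · intro x hx g _
      refine ⟨0, False, by norm_num, fun y hy _ _ _ _ => iff_false_intro fun H => H.1 ?_⟩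
      have := hk x hx; have := hk y hy; omega
  | succ k ihk =>
    induction R using Finset.strongInduction with
    | H R ih =>
      by_cases hbic : ∃ A ⊆ R, ∃ B ⊆ R, A.card = q ∧ B.card = q ∧ (∀ a ∈ A, h a = k + 1) ∧
          (∀ b ∈ B, h b = k) ∧ ∀ a ∈ A, ∀ b ∈ B, lt b a
      · obtain ⟨A, hAR, B, hBR, hA, hB, hAh, hBh, hAB⟩ := hbic
        have hsub : R \ (A ∪ B) ⊆ R := Finset.sdiff_subset
        have hss : R \ (A ∪ B) ⊂ R := by
          refine Finset.ssubset_iff_subset_ne.2 ⟨hsub, fun heq => ?_⟩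
          obtain ⟨a, ha⟩ := Finset.card_pos.1 (show 0 < A.card by omega)
          have := heq.symm ▸ hAR ha
          simp [ha] at this
        obtain ⟨num, F, hrec⟩ := ih _ hss ((Finset.card_le_card hsub).trans hn)
          (fun x hx => hk x (hsub hx)) (fun x hx y hy => hmono x (hsub hx) y (hsub hy))
        obtain ⟨num', h'⟩ := exists_isHalving_of_biclique htrans hq hk hmono hAR hBR hA hB hAh hBh
          hAB hrec
        exact ⟨num', F, h'⟩
      · push Not at hbic
        obtain ⟨O, hO, hON, hcov⟩ := exists_orientation_of_forall_not_biclique hδ hq hn hmono (k := k)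
          (fun A hA B hB h1 h2 h3 h4 H => by
            obtain ⟨a, ha, b, hb, hab⟩ := hbic A hA B hB h1 h2 h3 h4
            exact hab (H a ha b hb))
        -- The minimum merges levels `k` and `k + 1`. The only cross pairs lost by this lie on these
        -- two levels and are covered by `O`.
        obtain ⟨num, F, hinj, hlt, hF, hFQ, hstr⟩ := ihk (fun x => min (h x) k) R hn
          (fun x _ => min_le_right _ _)
          (fun x hx y hy hxy => min_le_min_right _ (hmono x hx y hy hxy))
        refine ⟨num, fun x => F x ∪ O x, hinj, hlt, fun x => ?_, fun x y hy => ?_,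
          fun x hx g hg => ?_⟩
        · refine (Finset.card_union_le _ _).trans ?_
          have := hF x; have := hO x
          rw [add_mul]; omega
        · rcases Finset.mem_union.1 hy with hy | hy
          · exact ⟨fun heq => (hFQ x y hy).1 (by simp [heq]), (hFQ x y hy).2⟩
          · exact hON x y hy
        · obtain ⟨s, c, hs2, hsc⟩ := hstr x hx g hg
          refine ⟨s, c, hs2, fun y hy h1 h2 h3 h4 => ?_⟩
          rw [Finset.mem_union, not_or] at h3 h4
          rw [← hsc y hy h1 h2 h3.1 h4.1]
          refine ⟨fun H => ⟨fun heq => ?_, H.2⟩, fun H => ⟨fun heq => H.1 (by simp [heq]), H.2⟩⟩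
          have hxk := hk x hx
          have hyk := hk y hy
          have hne := H.1
          simp only [min_def] at heq
          rcases hcov x hx y hy (by split_ifs at heq <;> omega) hxk
            (by split_ifs at heq <;> omega) hyk H with h5 | h5
          · exact h3.2 h5
          · exact h4.2 h5

end ReachLabel

/-! ### Reachability as comparability plus heights -/

/-- Two nodes one of which is reachable from the other. -/
def Digraph.Comparable {V : Type*} (G : Digraph V) (u v : V) : Prop := G.Reaches u v ∨ G.Reaches v u

theorem Digraph.Comparable.symm {V : Type*} {G : Digraph V} {u v : V} (h : G.Comparable u v) :
    G.Comparable v u := Or.symm h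

open Classical in
/-- The number of nodes from which `u` is reachable. -/
noncomputable def Digraph.height {V : Type*} [Fintype V] (G : Digraph V) (u : V) : ℕ :=
  (Finset.univ.filter fun z => G.Reaches z u).card

theorem Digraph.height_le_of_reaches {V : Type*} [Fintype V] {G : Digraph V} {u v : V}
    (h : G.Reaches u v) : G.height u ≤ G.height v :=
  Finset.card_le_card fun z hz => by
    simp only [Finset.mem_filter, Finset.mem_univ, true_and] at hz ⊢
    exact hz.trans h

open Classical in
theorem Digraph.height_lt_of_reaches {V : Type*} [Fintype V] {G : Digraph V} {u v : V}
    (h : G.Reaches u v) (h' : ¬ G.Reaches v u) : G.height u < G.height v := by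
  refine Finset.card_lt_card (Finset.ssubset_iff_subset_ne.2 ⟨fun z hz => ?_, fun heq => h' ?_⟩)
  · simp only [Finset.mem_filter, Finset.mem_univ, true_and] at hz ⊢
    exact hz.trans h
  · simpa using (Finset.ext_iff.1 heq v).2 
      (Finset.mem_filter.2 ⟨Finset.mem_univ v, Relation.ReflTransGen.refl⟩)

/-- The height grows strictly along a path that cannot be reversed, so it orients a comparable pair;
comparable nodes of equal height reach each other. -/
theorem Digraph.reaches_iff {V : Type*} [Fintype V] (G : Digraph V) (u v : V) :
    G.Reaches u v ↔ G.Comparable u v ∧ G.height u ≤ G.height v := by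
  refine ⟨fun h => ⟨Or.inl h, height_le_of_reaches h⟩, fun ⟨h, hle⟩ => ?_⟩
  by_contra hn
  exact (height_lt_of_reaches (h.resolve_left hn) hn).not_ge hle

theorem Digraph.height_le_card {n : ℕ} (G : Digraph (Fin n)) (u : Fin n) : G.height u ≤ n :=
  (Finset.card_le_univ _).trans (by simp)

/-! ### The numbering of the nodes of a digraph -/

namespace ReachLabel

/-- The nodes are numbered, the numbers are cut into groups of `2 * q` and the groups into triples.
Exceptional comparable pairs are stored in `F`; all comparable pairs in the same triple are
exceptional. Otherwise, each node is comparable with all or with none of the nodes of one half of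
each earlier group. -/
structure IsNumbering {n : ℕ} (C : Fin n → Fin n → Prop) (q d : ℕ) (num : Fin n → ℕ)
    (F : Fin n → Finset (Fin n)) : Prop where
  inj : Function.Injective num
  lt : ∀ x, num x < n
  card_le : ∀ x, (F x).card ≤ d
  comp : ∀ x, ∀ y ∈ F x, C x y
  triple : ∀ x y, num x / (2 * q) / 3 = num y / (2 * q) / 3 → C x y → y ∈ F x
  half : ∀ x, ∀ g < num x / (2 * q), ∃ (s : ℕ) (c : Prop), s < 2 ∧ ∀ y, num y / (2 * q) = g →
      num y % (2 * q) / q = s → y ∉ F x → x ∉ F y → (C x y ↔ c)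

theorem card_filter_div_le {V : Type*} [Fintype V] {f : V → ℕ} (hf : Function.Injective f) {b : ℕ}
    (hb : 0 < b) (c : ℕ) : (Finset.univ.filter fun y => f y / b = c).card ≤ b := by
  calc _ ≤ (Finset.Ico (c * b) (c * b + b)).card := by
        refine Finset.card_le_card_of_injOn f (fun y hy => ?_) hf.injOn
        have hy' : f y / b = c := by simpa using hy
        have h1 := Nat.div_add_mod (f y) b
        have h2 := Nat.mod_lt (f y) hb
        rw [hy', mul_comm] at h1
        simp only [Finset.coe_Ico, Set.mem_Ico]
        omega
    _ = b := by simp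

-- The bound on exceptions has three sources: the merges of levels, the at most `b` nodes of the own
-- level, and the at most `6 * q` nodes of the own triple.
open Classical in
theorem exists_isNumbering {n : ℕ} (G : Digraph (Fin n)) {q δ b : ℕ} (hq : 1 ≤ q) (hb : 1 ≤ b)
    (hδ : q * n ^ (q - 1) < δ ^ q) :
    ∃ num F, IsNumbering G.Comparable q (n / b * (δ + q) + b + 6 * q) num F := by
  let rank : Fin n → Fin n := (Tuple.sort G.height).symm
  have hrank : ∀ x y, G.Reaches x y → rank y < rank x → G.Reaches y x := by
    intro x y hxy hlt
    by_contra hyx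
    have h1 := Digraph.height_lt_of_reaches hxy hyx
    have h2 := Tuple.monotone_sort G.height hlt.le
    simp only [rank, Function.comp_apply, Equiv.apply_symm_apply] at h2
    omega
  have hrinj : Function.Injective fun x => (rank x : ℕ) :=
    Fin.val_injective.comp (Equiv.injective _)
  -- Breaking ties by rank inside strongly connected components makes this a strict order that still
  -- relates all comparable pairs of distinct nodes and is monotone for the levels.
  let lt : Fin n → Fin n → Prop := fun x y => G.Reaches x y ∧ rank x < rank y
  have hlt : ∀ x y, x ≠ y → (lt x y ∨ lt y x ↔ G.Comparable x y) := by
    intro x y hne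
    constructor
    · rintro (h | h)
      · exact Or.inl h.1
      · exact Or.inr h.1
    · rintro h
      have hne' : rank x ≠ rank y := fun h => hne ((Equiv.injective _) h)
      rcases lt_or_gt_of_ne hne' with hr | hr
      · exact Or.inl ⟨h.elim id fun h' => hrank _ _ h' hr, hr⟩
      · exact Or.inr ⟨h.elim (fun h' => hrank _ _ h' hr) id, hr⟩
  obtain ⟨num, F, hinj, hnum, hF, hFC, hhalf⟩ := exists_isHalving (lt := lt)
    (fun x y z h1 h2 => ⟨h1.1.trans h2.1, h1.2.trans h2.2⟩) hδ hq (n / b)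
    (fun x => (rank x : ℕ) / b) Finset.univ (by simp)
    (fun x _ => Nat.div_le_div_right (rank x).2.le)
    (fun x _ y _ h => Nat.div_le_div_right (Fin.le_def.1 h.2.le))
  replace hinj : Function.Injective num := fun x y h => hinj (by simp) (by simp) h
  have hC : ∀ x y, Cross lt (fun x => (rank x : ℕ) / b) x y → G.Comparable x y := fun x y h =>
    (hlt x y fun e => h.1 (by rw [e])).1 h.2
  let F' : Fin n → Finset (Fin n) := fun x => F x ∪
    ((Finset.univ.filter fun y => (rank y : ℕ) / b = (rank x : ℕ) / b) ∪
      (Finset.univ.filter fun y => num y / (2 * q) / 3 = num x / (2 * q) / 3)).filter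
        fun y => G.Comparable x y
  refine ⟨num, F', hinj, by simpa using hnum, fun x => ?_, fun x y hy => ?_, fun x y hxy hC' => ?_,
    fun x g hg => ?_⟩
  · have h1 := hF x
    have h2 := card_filter_div_le hrinj (b := b) hb ((rank x : ℕ) / b)
    have h3 := card_filter_div_le hinj (b := 2 * q * 3) (by omega) (num x / (2 * q * 3))
    have h4 := Finset.card_union_le (Finset.univ.filter fun y => (rank y : ℕ) / b = (rank x : ℕ) / b)
      (Finset.univ.filter fun y => num y / (2 * q) / 3 = num x / (2 * q) / 3)
    simp only [Nat.div_div_eq_div_mul] at h3 h4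
    refine (Finset.card_union_le _ _).trans ?_
    have h5 := Finset.card_filter_le (p := fun y => G.Comparable x y)
      ((Finset.univ.filter fun y => (rank y : ℕ) / b = (rank x : ℕ) / b) ∪
      (Finset.univ.filter fun y => num y / (2 * q) / 3 = num x / (2 * q) / 3))
    simp only [Nat.div_div_eq_div_mul] at h5 ⊢
    omega
  · rcases Finset.mem_union.1 hy with hy | hy
    · exact hC x y (hFC x y hy)
    · exact (Finset.mem_filter.1 hy).2
  · refine Finset.mem_union_right _ (Finset.mem_filter.2 ⟨Finset.mem_union_right _ ?_, hC'⟩)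
    simpa using hxy.symm
  · obtain ⟨s, c, hs2, hsc⟩ := hhalf x (Finset.mem_univ x) g hg
    refine ⟨s, c, hs2, fun y h1 h2 h3 h4 => ?_⟩
    have h5 : y ∉ F x := fun h => h3 (Finset.mem_union_left _ h)
    have h6 : x ∉ F y := fun h => h4 (Finset.mem_union_left _ h)
    rw [← hsc y (Finset.mem_univ y) h1 h2 h5 h6]
    refine ⟨fun h => ⟨fun heq => h3 ?_, ?_⟩, hC x y⟩
    · refine Finset.mem_union_right _ (Finset.mem_filter.2 ⟨Finset.mem_union_left _ ?_, h⟩)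
      simpa using heq.symm
    · exact (hlt x y fun e => by subst e; omega).2 h

end ReachLabel

namespace WordRAM.Expr

/-! ### The decoder as an expression -/

/-- The bit at position `e` of an input string. -/
def bit (X : Input) (e : Expr) : Expr := bin .mod (window X e) (const 2)

/-- The power `2 ^ p`, where `p` is the field width used in the labels. -/
def pow : Expr := bin .div (lowBit (read .source (const 0))) (const 2)

/-- The field width used in the labels. -/
def width : Expr :=
  bin .mod (bin .div (read .source (const 0)) (lowBit (read .source (const 0)))) pow

/-- The field number `e` of a label. -/
def field (X : Input) (e : Expr) : Expr :=
  bin .mod (window X (bin .add (bin .add width (const 1)) (bin .mul width e))) pow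

/-- Half of the group size. -/
def half : Expr := field .source (const 1)

/-- The height of a node. -/
def height (X : Input) : Expr := field X (const 2)

/-- The number of a node. -/
def number (X : Input) : Expr := field X (const 3)

/-- The position of the main table. -/
def tableStart : Expr := field .source (const 4)

/-- The group size. -/
def size : Expr := bin .mul (const 2) half

/-- The group of a node. -/
def group (X : Input) : Expr := bin .div (number X) size

/-- The triple of a node. -/
def triple (X : Input) : Expr := bin .div (group X) (const 3)

/-- The position of a node inside its group. -/
def index (X : Input) : Expr := bin .mod (number X) size

/-- Whether the number of the node `Y` occurs in the exception list of the node `X`. -/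
def exception (X Y : Input) : Expr :=
  bit X (bin .add
    (field X (bin .add (const 5) (bin .div (number Y) (bin .mul width width))))
    (bin .mod (number Y) (bin .mul width width)))

/-- The position of the record for the triple of the node `X`. -/
def record (X : Input) : Expr :=
  bin .add tableStart (bin .mul (triple X) (bin .add size (const 12)))

/-- Which of the two nodes in different triples holds the information about them. -/
def owner : Expr := bin .mod (bin .add (group .source) (group .target)) (const 3)

/-- The position of the control bits for the half group of `Y`. -/
def control (Y : Input) : Expr :=
  bin .add (record Y) (bin .add size (bin .add (bin .mul (const 4) (bin .mod (group Y) (const 3)))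
    (bin .mul (const 2) (bin .div (index Y) half))))

/-- The table lookup for a node `X` in a later triple than the node `Y`. -/
def lookup (X Y : Input) : Expr :=
  bin .add
    (bin .mul (lt owner (const 2))
      (bin .add
        (bin .mul
          (bit X (bin .add (record Y) (bin .add (bin .mul owner half) (bin .mod (index Y) half))))
          (bit X (control Y)))
        (bit X (bin .add (control Y) (const 1)))))
    (bin .mul (le (const 2) owner) (bit Y (bin .add (record X) (index X))))

/-- A positive value if and only if the two nodes are comparable. -/
def comparable : Expr :=
  bin .add (bin .add (exception .source .target) (exception .target .source))
    (bin .add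
      (bin .mul (lt (triple .target) (triple .source)) (lookup .source .target))
      (bin .mul (lt (triple .source) (triple .target)) (lookup .target .source)))

/-- The decoder. -/
def decoder : Expr :=
  bin .mul (nz comparable) (le (height .source) (height .target))

end WordRAM.Expr

/-! ### The values of the decoder on well-formed labels -/

namespace ReachLabel

/-- A bit of a string, as a number. -/
def bitAt (s : List Bool) (i : ℕ) : ℕ := (s.getD i false).toNat

theorem bitAt_le (s : List Bool) (i : ℕ) : bitAt s i ≤ 1 := Bool.toNat_le _

/-- The position of the record for the triple of the node with number `a`. -/
def recordPos (q M a : ℕ) : ℕ := M + a / (2 * q) / 3 * (2 * q + 12)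

/-- The position of the control bits for the half group of the node with number `b`. -/
def controlPos (q M b : ℕ) : ℕ :=
  recordPos q M b + (2 * q + (4 * (b / (2 * q) % 3) + 2 * (b % (2 * q) / q)))

/-- The table lookup for nodes number `a` with label `s` and number `b` with label `t`, the former
in a later triple than the latter. -/
def lookupVal (q M r : ℕ) (s t : List Bool) (a b : ℕ) : ℕ :=
  (if r < 2 then 1 else 0) *
    (bitAt s (recordPos q M b + (r * q + b % (2 * q) % q)) * bitAt s (controlPos q M b) +
      bitAt s (controlPos q M b + 1)) +
  (if 2 ≤ r then 1 else 0) * bitAt t (recordPos q M a + a % (2 * q))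

theorem lookupVal_le (q M r : ℕ) (s t : List Bool) (a b : ℕ) : lookupVal q M r s t a b ≤ 3 := by
  have h1 := bitAt_le s (recordPos q M b + (r * q + b % (2 * q) % q))
  have h2 := bitAt_le s (controlPos q M b)
  have h3 := bitAt_le s (controlPos q M b + 1)
  have h4 := bitAt_le t (recordPos q M a + a % (2 * q))
  have h5 := Nat.mul_le_mul h1 h2
  unfold lookupVal
  split_ifs <;> omega

/-- A string that begins with `p` zeros, a one, and `m` fields of width `p` with the values
`f k`. -/
structure HasFields (p m : ℕ) (f : ℕ → ℕ) (s : List Bool) : Prop where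
  zero : ∀ i < p, s.getD i false = false
  one : s.getD p false = true
  field : ∀ k < m, ∀ j < p, s.getD (p + 1 + p * k + j) false = (f k).testBit j
  lt : ∀ k, f k < 2 ^ p

end ReachLabel

namespace WordRAM.Expr

open ReachLabel

theorem Val.bitAt {w : ℕ} {x y : List Bool} {e : Expr} {a : ℕ} (X : Input)
    (he : e.Val w x y a) (ha : a + 1 < 2 ^ w) (hw : 1 < w) :
    (Expr.bit X e).Val w x y (ReachLabel.bitAt (X.string x y) a) :=
  he.bit X ha hw

/-- The situation of the decoder: two strings with fields, whose first fields are the field width,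
half of the group size, height and number of the node, and the position of the main table. -/
structure Decodable (w p q M m : ℕ) (x y : List Bool) (f : Input → ℕ → ℕ) : Prop where
  fields : ∀ X, HasFields p m (f X) (X.string x y)
  f0 : ∀ X, f X 0 = p
  f1 : ∀ X, f X 1 = q
  f4 : ∀ X, f X 4 = M
  hm : ∀ X, 5 + f X 3 / (p * p) < m
  hp : 16 ≤ p
  hq : 1 ≤ q
  hw : 8 * p ≤ w

namespace Decodable

variable {w p q M m : ℕ} {x y : List Bool} {f : Input → ℕ → ℕ}

theorem two_pow_le (H : Decodable w p q M m x y f) : (2 ^ p) ^ 8 ≤ 2 ^ w := by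
  rw [← pow_mul]
  exact Nat.pow_le_pow_right two_pos (by have := H.hw; omega)

theorem le_two_pow (H : Decodable w p q M m x y f) : 65536 ≤ 2 ^ p :=
  (Nat.pow_le_pow_right two_pos H.hp).trans' (by norm_num)

/-- Field and record positions are, up to small constants and lower terms, products of two numbers
below `2 ^ p`; this leaves room against wraparound. -/
theorem cube_le (H : Decodable w p q M m x y f) : 65536 * (2 ^ p) ^ 3 ≤ 2 ^ w := by
  refine le_trans ?_ H.two_pow_le
  calc 65536 * (2 ^ p) ^ 3 ≤ 2 ^ p * (2 ^ p) ^ 3 := Nat.mul_le_mul_right _ H.le_two_pow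
    _ = (2 ^ p) ^ 4 := by ring
    _ ≤ _ := Nat.pow_le_pow_right (by positivity) (by norm_num)

/-- Numbers that are small compared to `2 ^ w`. -/
theorem lt_two_pow (H : Decodable w p q M m x y f) {a : ℕ} (ha : a ≤ 64 * 2 ^ p) :
    a + 2 < 2 ^ w := by
  have h1 := H.cube_le
  have h2 := H.le_two_pow
  have h3 : 2 ^ p ≤ (2 ^ p) ^ 3 := Nat.le_self_pow (by norm_num) _
  omega

/-- One word holds the unary prefix and all of field 0. That field repeats `p`, so the width is
available as a number without computing a logarithm. -/
theorem first (H : Decodable w p q M m x y f) :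
    ∃ k, (read .source (const 0)).Val w x y (2 ^ p * (2 * k + 1)) ∧
      2 ^ p * (2 * k + 1) < 2 ^ w ∧ k % 2 ^ p = p := by
  have hF := H.fields .source
  have hw := H.hw
  have hp := H.hp
  set s := Input.string x y .source with hs
  set V := (packed w s 0).toNat with hV
  have hbit : ∀ j < w, V.testBit j = s.getD j false := by
    intro j hj
    have := getLsbD_packed w s 0 j
    simp only [BitVec.getLsbD, hj, decide_true, Bool.true_and] at this
    simpa using this
  have hmod : V % 2 ^ (p + 1) = 2 ^ p := by
    apply Nat.eq_of_testBit_eq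
    intro j
    rw [Nat.testBit_mod_two_pow, Nat.testBit_two_pow]
    rcases lt_trichotomy j p with h | h | h
    · rw [hbit j (by omega), hF.zero j h]; simp; omega
    · subst h; rw [hbit j (by omega), hF.one]; simp
    · simp [show ¬ j < p + 1 by omega]; omega
  have hm : 0 < m := (Nat.zero_le _).trans_lt (H.hm .source)
  refine ⟨V / 2 ^ (p + 1), ?_, ?_, ?_⟩
  · have := Nat.div_add_mod V (2 ^ (p + 1))
    rw [hmod] at this
    have e : 2 ^ p * (2 * (V / 2 ^ (p + 1)) + 1) = V := by
      conv_rhs => rw [← this]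
      ring
    rw [e]
    simp [Val, eval, hV, hs]
  · have := Nat.div_add_mod V (2 ^ (p + 1))
    rw [hmod] at this
    have e : 2 ^ p * (2 * (V / 2 ^ (p + 1)) + 1) = V := by
      conv_rhs => rw [← this]
      ring
    rw [e]
    exact (packed w s 0).isLt
  · apply Nat.eq_of_testBit_eq
    intro j
    rw [Nat.testBit_mod_two_pow, Nat.testBit_div_two_pow]
    by_cases hj : j < p
    · have := hF.field 0 hm j hj
      rw [H.f0] at this
      rw [hbit _ (by omega), ← this]
      simp [hj, add_comm]
    · have := Nat.testBit_lt_two_pow (Nat.lt_two_pow_self.trans_le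
        (Nat.pow_le_pow_right two_pos (not_lt.1 hj)) : p < 2 ^ j)
      simp [hj, this]

theorem pow (H : Decodable w p q M m x y f) : pow.Val w x y (2 ^ p) := by
  obtain ⟨k, hk, -, -⟩ := H.first
  have h := hk.lowBit.div (val_const 2)
    (by rw [pow_succ]; have := H.lt_two_pow (a := 2 ^ p * 2) (by omega); omega)
    (by have := H.lt_two_pow (a := 2) (by have := H.le_two_pow; omega); omega)
  rwa [pow_succ, Nat.mul_div_cancel _ two_pos] at h

theorem width (H : Decodable w p q M m x y f) : width.Val w x y p := by
  obtain ⟨k, hk, hlt, hkp⟩ := H.first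
  have h1 := H.lt_two_pow (a := 2 ^ (p + 1)) (by rw [pow_succ]; omega)
  have h2 := H.lt_two_pow (a := 2 ^ p) (by omega)
  have h := (hk.div hk.lowBit hlt (by omega)).mod H.pow
    ((Nat.div_le_self _ _).trans_lt hlt) (by omega)
  have e : 2 ^ p * (2 * k + 1) / 2 ^ (p + 1) = k := by
    rw [pow_succ, Nat.mul_div_mul_left _ _ (by positivity)]; omega
  rwa [e, hkp] at h

theorem p_lt (p : ℕ) : p < 2 ^ p := Nat.lt_two_pow_self

theorem fieldVal (H : Decodable w p q M m x y f) (X : Input) {e : Expr} {k : ℕ}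
    (he : e.Val w x y k) (hk : k < m) (hk' : k ≤ 2 * 2 ^ p) : (field X e).Val w x y (f X k) := by
  have hp := H.hp
  have hw := H.hw
  have hb : p + 1 + p * k + 1 < 2 ^ w := by
    have h1 := H.cube_le
    have h2 := H.le_two_pow
    have h3 : p * k ≤ 2 ^ p * (2 * 2 ^ p) := Nat.mul_le_mul (p_lt p).le hk'
    have h4 : (2 ^ p) ^ 3 = 2 ^ p * (2 ^ p * 2 ^ p) := by ring
    have h5 : 2 ^ p * 2 ^ p ≤ 2 ^ p * (2 ^ p * 2 ^ p) := Nat.le_mul_of_pos_left _ (by positivity)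
    have h6 : 2 ^ p ≤ 2 ^ p * 2 ^ p := Nat.le_mul_of_pos_left _ (by positivity)
    have h7 := p_lt p
    have h8 : 2 ^ p * (2 * 2 ^ p) = 2 * (2 ^ p * 2 ^ p) := by ring
    omega
  exact ((H.width.add (val_const 1)).add (H.width.mul he)).field X hb (by omega) H.pow
    ((H.fields X).lt k) ((H.fields X).field k hk)

theorem five_lt (H : Decodable w p q M m x y f) : 5 < m :=
  (Nat.le_add_right _ _).trans_lt (H.hm .source)

theorem q_lt (H : Decodable w p q M m x y f) : q < 2 ^ p := by
  have := (H.fields .source).lt 1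
  rwa [H.f1] at this

theorem M_lt (H : Decodable w p q M m x y f) : M < 2 ^ p := by
  have := (H.fields .source).lt 4
  rwa [H.f4] at this

theorem number_lt (H : Decodable w p q M m x y f) (X : Input) : f X 3 < 2 ^ p :=
  (H.fields X).lt 3

theorem half (H : Decodable w p q M m x y f) : half.Val w x y q := by
  have h := H.fieldVal .source (val_const 1) (by have := H.five_lt; omega)
    (by have := H.le_two_pow; omega)
  rwa [H.f1] at h

theorem height (H : Decodable w p q M m x y f) (X : Input) : (height X).Val w x y (f X 2) :=
  H.fieldVal X (val_const 2) (by have := H.five_lt; omega) (by have := H.le_two_pow; omega)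

theorem number (H : Decodable w p q M m x y f) (X : Input) : (number X).Val w x y (f X 3) :=
  H.fieldVal X (val_const 3) (by have := H.five_lt; omega) (by have := H.le_two_pow; omega)

theorem tableStart (H : Decodable w p q M m x y f) : tableStart.Val w x y M := by
  have h := H.fieldVal .source (val_const 4) (by have := H.five_lt; omega)
    (by have := H.le_two_pow; omega)
  rwa [H.f4] at h

theorem size (H : Decodable w p q M m x y f) : size.Val w x y (2 * q) := (val_const 2).mul H.half

theorem group (H : Decodable w p q M m x y f) (X : Input) :
    (group X).Val w x y (f X 3 / (2 * q)) := by
  have h1 := H.lt_two_pow (a := f X 3) (by have := H.number_lt X; omega)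
  have h2 := H.lt_two_pow (a := 2 * q) (by have := H.q_lt; omega)
  exact (H.number X).div H.size (by omega) (by omega)

theorem group_lt (H : Decodable w p q M m x y f) (X : Input) : f X 3 / (2 * q) < 2 ^ p :=
  (Nat.div_le_self _ _).trans_lt (H.number_lt X)

theorem triple (H : Decodable w p q M m x y f) (X : Input) :
    (triple X).Val w x y (f X 3 / (2 * q) / 3) := by
  have h1 := H.lt_two_pow (a := f X 3 / (2 * q)) (by have := H.group_lt X; omega)
  have h2 := H.lt_two_pow (a := 3) (by have := H.le_two_pow; omega)
  exact (H.group X).div (val_const 3) (by omega) (by omega)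

theorem triple_lt (H : Decodable w p q M m x y f) (X : Input) : f X 3 / (2 * q) / 3 < 2 ^ p :=
  (Nat.div_le_self _ _).trans_lt (H.group_lt X)

theorem index (H : Decodable w p q M m x y f) (X : Input) :
    (index X).Val w x y (f X 3 % (2 * q)) := by
  have h1 := H.lt_two_pow (a := f X 3) (by have := H.number_lt X; omega)
  have h2 := H.lt_two_pow (a := 2 * q) (by have := H.q_lt; omega)
  exact (H.number X).mod H.size (by omega) (by omega)

theorem index_lt (H : Decodable w p q M m x y f) (X : Input) : f X 3 % (2 * q) < 2 * q :=
  Nat.mod_lt _ (by have := H.hq; omega)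

theorem one_lt_w (H : Decodable w p q M m x y f) : 1 < w := by
  have := H.hp; have := H.hw; omega

theorem exception (H : Decodable w p q M m x y f) (X Y : Input) : (exception X Y).Val w x y
    (bitAt (X.string x y) (f X (5 + f Y 3 / (p * p)) + f Y 3 % (p * p))) := by
  have hY := H.number_lt Y
  have hZ := H.le_two_pow
  have h1 := H.lt_two_pow (a := f Y 3) (by omega)
  have h2 : p * p < 2 ^ w := by
    have h1 := H.cube_le
    have h3 : p * p ≤ 2 ^ p * 2 ^ p := Nat.mul_le_mul (p_lt p).le (p_lt p).le
    have h4 : (2 ^ p) ^ 3 = 2 ^ p * (2 ^ p * 2 ^ p) := by ring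
    have h5 : 2 ^ p * 2 ^ p ≤ 2 ^ p * (2 ^ p * 2 ^ p) := Nat.le_mul_of_pos_left _ (by positivity)
    have h6 : 0 < 2 ^ p * 2 ^ p := by positivity
    omega
  have hsq := H.width.mul H.width
  have h3 := Nat.div_le_self (f Y 3) (p * p)
  have h4 := Nat.mod_le (f Y 3) (p * p)
  have hk := H.fieldVal X ((val_const 5).add ((H.number Y).div hsq (by omega) h2)) (H.hm Y)
    (by omega)
  have h5 := (H.fields X).lt (5 + f Y 3 / (p * p))
  refine (hk.add ((H.number Y).mod hsq (by omega) h2)).bitAt X ?_ H.one_lt_w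
  have := H.lt_two_pow (a := f X (5 + f Y 3 / (p * p)) + f Y 3 % (p * p)) (by omega)
  omega

theorem record (H : Decodable w p q M m x y f) (X : Input) :
    (record X).Val w x y (recordPos q M (f X 3)) :=
  H.tableStart.add ((H.triple X).mul (H.size.add (val_const 12)))

theorem recordPos_lt (H : Decodable w p q M m x y f) (X : Input) {i : ℕ} (hi : i ≤ 64 * 2 ^ p) :
    recordPos q M (f X 3) + i + 2 < 2 ^ w := by
  have h1 := H.cube_le
  have h2 := H.le_two_pow
  have h3 := H.triple_lt X
  have h4 := H.q_lt
  have h5 := H.M_lt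
  have h6 : f X 3 / (2 * q) / 3 * (2 * q + 12) ≤ 2 ^ p * (14 * 2 ^ p) :=
    Nat.mul_le_mul h3.le (by omega)
  have h7 : 2 ^ p * (14 * 2 ^ p) = 14 * (2 ^ p * 2 ^ p) := by ring
  have e : (2 ^ p) ^ 3 = 2 ^ p * (2 ^ p * 2 ^ p) := by ring
  have h8 : 2 ^ p * 2 ^ p ≤ 2 ^ p * (2 ^ p * 2 ^ p) := Nat.le_mul_of_pos_left _ (by positivity)
  have h9 : 2 ^ p ≤ 2 ^ p * 2 ^ p := Nat.le_mul_of_pos_left _ (by positivity)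
  unfold recordPos
  omega

/-- The value of `owner`. -/
theorem owner (H : Decodable w p q M m x y f) : owner.Val w x y
    ((f .source 3 / (2 * q) + f .target 3 / (2 * q)) % 3) := by
  have h1 := H.group_lt .source
  have h2 := H.group_lt .target
  have h3 := H.lt_two_pow (a := f .source 3 / (2 * q) + f .target 3 / (2 * q)) (by omega)
  have h4 := H.lt_two_pow (a := 3) (by have := H.le_two_pow; omega)
  exact ((H.group _).add (H.group _)).mod (val_const 3) (by omega) (by omega)

theorem control (H : Decodable w p q M m x y f) (X : Input) :
    (control X).Val w x y (controlPos q M (f X 3)) := by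
  have h1 := H.lt_two_pow (a := f X 3 / (2 * q)) (by have := H.group_lt X; omega)
  have h2 := H.lt_two_pow (a := 3) (by have := H.le_two_pow; omega)
  have h3 := H.lt_two_pow (a := f X 3 % (2 * q)) (by have := H.index_lt X; have := H.q_lt; omega)
  have h4 := H.lt_two_pow (a := q) (by have := H.q_lt; omega)
  exact (H.record X).add (H.size.add
    (((val_const 4).mul ((H.group X).mod (val_const 3) (by omega) (by omega))).add
      ((val_const 2).mul ((H.index X).div H.half (by omega) (by omega)))))

theorem controlPos_lt (H : Decodable w p q M m x y f) (X : Input) :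
    controlPos q M (f X 3) + 3 < 2 ^ w := by
  have h1 := H.q_lt
  have h2 := H.le_two_pow
  have h3 : f X 3 % (2 * q) / q ≤ 1 :=
    Nat.le_of_lt_succ (Nat.div_lt_of_lt_mul (by have := H.index_lt X; omega))
  have := H.recordPos_lt X
    (i := 2 * q + (4 * (f X 3 / (2 * q) % 3) + 2 * (f X 3 % (2 * q) / q)) + 1) (by omega)
  unfold controlPos
  omega

theorem lookup (H : Decodable w p q M m x y f) (X Y : Input) :
    (lookup X Y).Val w x y (lookupVal q M
      ((f .source 3 / (2 * q) + f .target 3 / (2 * q)) % 3) (X.string x y) (Y.string x y)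
      (f X 3) (f Y 3)) := by
  have hr : (f .source 3 / (2 * q) + f .target 3 / (2 * q)) % 3 < 3 := Nat.mod_lt _ (by norm_num)
  set r := (f .source 3 / (2 * q) + f .target 3 / (2 * q)) % 3 with hrdef
  have hZ := H.le_two_pow
  have hq := H.q_lt
  have h1 := H.lt_two_pow (a := 3) (by omega)
  have hYq : f Y 3 % (2 * q) % q < q := Nat.mod_lt _ H.hq
  have h3 := H.lt_two_pow (a := f Y 3 % (2 * q)) (by have := H.index_lt Y; omega)
  have h4 := H.lt_two_pow (a := q) (by omega)
  have hrq : r * q ≤ 2 * q := Nat.mul_le_mul_right _ (by omega)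
  have hown : Expr.owner.Val w x y r := H.owner
  have hc := H.controlPos_lt Y
  refine (((hown.lt (val_const 2) (by omega) (by omega))).mul
    (((Val.bitAt X ((H.record Y).add ((hown.mul H.half).add
      ((H.index Y).mod H.half (by omega) (by omega)))) ?_ H.one_lt_w).mul
      ((H.control Y).bitAt X (by omega) H.one_lt_w)).add
      (((H.control Y).add (val_const 1)).bitAt X (by omega) H.one_lt_w))).add
    (((val_const 2).le hown (by omega) (by omega)).mul
      (((H.record X).add (H.index X)).bitAt Y ?_ H.one_lt_w))
  · have := H.recordPos_lt Y (i := r * q + f Y 3 % (2 * q) % q) (by omega)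
    omega
  · have := H.recordPos_lt X (i := f X 3 % (2 * q)) (by have := H.index_lt X; omega)
    omega

/-- Both lookups are always evaluated, and an inapplicable one is multiplied by zero. The sum is at
most 8, so a positive value cannot wrap around to zero. -/
theorem decoder (H : Decodable w p q M m x y f) {C : Prop}
    (hC : C ↔ 0 < bitAt (Input.string x y .source)
      (f .source (5 + f .target 3 / (p * p)) + f .target 3 % (p * p)) +
      bitAt (Input.string x y .target)
      (f .target (5 + f .source 3 / (p * p)) + f .source 3 % (p * p)) +
      ((if f .target 3 / (2 * q) / 3 < f .source 3 / (2 * q) / 3 then 1 else 0) *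
        lookupVal q M ((f .source 3 / (2 * q) + f .target 3 / (2 * q)) % 3)
          (Input.string x y .source) (Input.string x y .target)
          (f .source 3) (f .target 3) +
      (if f .source 3 / (2 * q) / 3 < f .target 3 / (2 * q) / 3 then 1 else 0) *
        lookupVal q M ((f .source 3 / (2 * q) + f .target 3 / (2 * q)) % 3)
          (Input.string x y .target) (Input.string x y .source)
          (f .target 3) (f .source 3))) :
    (C ∧ f .source 2 ≤ f .target 2 → decoder.eval w x y = 1) ∧
      (¬ (C ∧ f .source 2 ≤ f .target 2) → decoder.eval w x y = 0) := by
  have hZ := H.le_two_pow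
  have ht : ∀ X, f X 3 / (2 * q) / 3 + 2 < 2 ^ w := fun X =>
    H.lt_two_pow (by have := H.triple_lt X; omega)
  have hh : ∀ X, f X 2 + 2 < 2 ^ w := fun X =>
    H.lt_two_pow (by have := (H.fields X).lt 2; omega)
  have h8 := H.lt_two_pow (a := 8) (by omega)
  have hcomp := ((H.exception .source .target).add (H.exception .target .source)).add
    ((((H.triple .target).lt (H.triple .source) (ht _) (by have := ht .source; omega)).mul
      (H.lookup .source .target)).add
    (((H.triple .source).lt (H.triple .target) (ht _) (by have := ht .target; omega)).mul
      (H.lookup .target .source)))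
  have hle := (H.height .source).le (H.height .target) (by have := hh .source; omega)
    (by have := hh .target; omega)
  have hdec := (hcomp.nz ?_).mul hle
  · unfold Val at hdec
    constructor
    · rintro ⟨h1, h2⟩
      rw [if_pos (hC.1 h1), if_pos h2] at hdec
      exact hdec
    · intro h
      rcases not_and_or.1 h with h | h
      · rw [if_neg (fun h' => h (hC.2 h')), zero_mul] at hdec
        exact hdec
      · rw [if_neg h, mul_zero] at hdec
        exact hdec
  · have h1 := bitAt_le (Input.string x y .source)
      (f .source (5 + f .target 3 / (p * p)) + f .target 3 % (p * p))
    have h2 := bitAt_le (Input.string x y .target)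
      (f .target (5 + f .source 3 / (p * p)) + f .source 3 % (p * p))
    have h3 := lookupVal_le q M ((f .source 3 / (2 * q) + f .target 3 / (2 * q)) % 3)
      (Input.string x y .source) (Input.string x y .target) (f .source 3) (f .target 3)
    have h4 := lookupVal_le q M ((f .source 3 / (2 * q) + f .target 3 / (2 * q)) % 3)
      (Input.string x y .target) (Input.string x y .source) (f .target 3) (f .source 3)
    split_ifs <;> omega

end Decodable

end WordRAM.Expr

/-! ### The main table and the correctness of its lookup -/

namespace ReachLabel

/-- The content of the main table of the node `v`, at offset `o` of the record for the triple `T`.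
The node `z` of a group in this triple is described in the table of the node in the earlier or of
the node in the later triple, depending on the sum of the group numbers. The nodes of the half
`s v g` of the group `g` are all comparable with `v` if `c v g` holds, and none of them is if it does
not. -/
def TableBit {n : ℕ} (C : Fin n → Fin n → Prop) (q : ℕ) (num : Fin n → ℕ) (s : Fin n → ℕ → ℕ)
    (c : Fin n → ℕ → Prop) (v : Fin n) (T o : ℕ) : Prop :=
  (o < 2 * q ∧ num v / (2 * q) / 3 < T ∧ ∃ z, num z / (2 * q) / 3 = T ∧
    2 ≤ (num z / (2 * q) + num v / (2 * q)) % 3 ∧ num z % (2 * q) = o ∧ C v z) ∨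
  (o < 2 * q ∧ T < num v / (2 * q) / 3 ∧ ∃ z, num z / (2 * q) / 3 = T ∧
    (num z / (2 * q) + num v / (2 * q)) % 3 < 2 ∧
    (num z / (2 * q) + num v / (2 * q)) % 3 * q + num z % (2 * q) % q = o ∧
    num z % (2 * q) / q ≠ s v (num z / (2 * q)) ∧ C v z) ∨
  (2 * q ≤ o ∧ (o - 2 * q) % 2 = 0 ∧ (o - 2 * q) % 4 / 2 ≠ s v (3 * T + (o - 2 * q) / 4)) ∨
  (2 * q ≤ o ∧ (o - 2 * q) % 2 = 1 ∧ (o - 2 * q) % 4 / 2 = s v (3 * T + (o - 2 * q) / 4) ∧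
    c v (3 * T + (o - 2 * q) / 4))

section lookup

variable {n q M d : ℕ} {C : Fin n → Fin n → Prop} {num : Fin n → ℕ} {F : Fin n → Finset (Fin n)}
  {s : Fin n → ℕ → ℕ} {c : Fin n → ℕ → Prop} {lab : Fin n → List Bool}

/-- Each of the six halves of a triple has two control bits, at most one of them set: the first
enables the table bit for a non-uniform half, the second answers directly for the uniform one. -/
theorem bitAt_control_iff (hq : 1 ≤ q)
    (htab : ∀ v y o, o < 2 * q + 12 → (0 < bitAt (lab v) (recordPos q M (num y) + o) ↔
      TableBit C q num s c v (num y / (2 * q) / 3) o)) (x y : Fin n) :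
    (0 < bitAt (lab x) (controlPos q M (num y)) ↔
      num y % (2 * q) / q ≠ s x (num y / (2 * q))) ∧
    (0 < bitAt (lab x) (controlPos q M (num y) + 1) ↔
      num y % (2 * q) / q = s x (num y / (2 * q)) ∧ c x (num y / (2 * q))) := by
  have hside : num y % (2 * q) / q ≤ 1 :=
    Nat.le_of_lt_succ (Nat.div_lt_of_lt_mul
      (by have := Nat.mod_lt (num y) (show 2 * q > 0 by omega); omega))
  unfold controlPos
  set t := num y % (2 * q) / q
  set g := num y / (2 * q)
  have e0 : 3 * (g / 3) + g % 3 = g := Nat.div_add_mod g 3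
  constructor
  · rw [htab x y _ (by omega), TableBit]
    have e1 : 2 * q + (4 * (g % 3) + 2 * t) - 2 * q = 4 * (g % 3) + 2 * t := by omega
    have e2 : (4 * (g % 3) + 2 * t) / 4 = g % 3 := by omega
    have e3 : (4 * (g % 3) + 2 * t) % 4 / 2 = t := by omega
    have e4 : (4 * (g % 3) + 2 * t) % 2 = 0 := by omega
    rw [e1, e2, e3, e4, e0]
    simp
  · rw [add_assoc, htab x y _ (by omega), TableBit]
    have e1 : 2 * q + (4 * (g % 3) + 2 * t) + 1 - 2 * q = 4 * (g % 3) + 2 * t + 1 := by omega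
    have e2 : (4 * (g % 3) + 2 * t + 1) / 4 = g % 3 := by omega
    have e3 : (4 * (g % 3) + 2 * t + 1) % 4 / 2 = t := by omega
    have e4 : (4 * (g % 3) + 2 * t + 1) % 2 = 1 := by omega
    have e5 : ¬ 2 * q + (4 * (g % 3) + 2 * t) + 1 < 2 * q := by omega
    have e6 : 2 * q ≤ 2 * q + (4 * (g % 3) + 2 * t) + 1 := by omega
    rw [e1, e2, e3, e4, e0]
    simp [e5, e6]

/-- A table bit names a single node. Inside a triple the residue determines the group; for residues
0 and 1 the offset `r * q + i` reveals both residue and place in the half, and the half is the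
non-uniform one. For residue 2 the offset is the place in the whole group. -/
theorem lookupVal_pos_iff (hq : 1 ≤ q) (hC : ∀ x y, C x y → C y x)
    (hnum : IsNumbering C q d num F)
    (hs2 : ∀ x, ∀ g < num x / (2 * q), s x g < 2)
    (hs : ∀ x, ∀ g < num x / (2 * q), ∀ y, num y / (2 * q) = g →
      num y % (2 * q) / q = s x g → y ∉ F x → x ∉ F y → (C x y ↔ c x g))
    (htab : ∀ v y o, o < 2 * q + 12 → (0 < bitAt (lab v) (recordPos q M (num y) + o) ↔
      TableBit C q num s c v (num y / (2 * q) / 3) o))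
    {x y : Fin n} (hxy : num y / (2 * q) / 3 < num x / (2 * q) / 3) {r : ℕ}
    (hr : r = (num y / (2 * q) + num x / (2 * q)) % 3) (h1 : y ∉ F x) (h2 : x ∉ F y) :
    0 < lookupVal q M r (lab x) (lab y) (num x) (num y) ↔ C x y := by
  have hq2 : 0 < 2 * q := by omega
  have uniq : ∀ z, num z / (2 * q) = num y / (2 * q) → num z % (2 * q) = num y % (2 * q) → z = y := by
    intro z e1 e2
    apply hnum.inj
    rw [← Nat.div_add_mod (num z) (2 * q), ← Nat.div_add_mod (num y) (2 * q), e1, e2]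
  have hgroup : num y / (2 * q) < num x / (2 * q) := by omega
  have hi : num y % (2 * q) % q < q := Nat.mod_lt _ hq
  unfold lookupVal
  rcases Nat.lt_or_ge r 2 with hr2 | hr2
  · have hrq : r * q ≤ 1 * q := Nat.mul_le_mul_right _ (by omega)
    rw [if_pos hr2, if_neg (by omega), zero_mul, one_mul, add_zero, Nat.add_pos_iff_pos_or_pos,
      CanonicallyOrderedAdd.mul_pos, (bitAt_control_iff hq htab x y).1,
      (bitAt_control_iff hq htab x y).2]
    by_cases hside : num y % (2 * q) / q = s x (num y / (2 * q))
    · rw [hs x _ hgroup y rfl hside h1 h2]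
      simp [hside]
    · simp only [ne_eq, hside, not_false_eq_true, and_true, false_and, or_false]
      rw [htab x y _ (by omega), TableBit]
      constructor
      · rintro (H | ⟨-, -, z, e1, e2, e3, e4, e5⟩ | H | H)
        · omega
        · have e6 : num z % (2 * q) % q < q := Nat.mod_lt _ hq
          have e7 : (num z / (2 * q) + num x / (2 * q)) % 3 = r := by
            have := congrArg (· / q) e3
            simpa [Nat.add_comm, Nat.add_mul_div_right _ _ hq, Nat.div_eq_of_lt e6,
              Nat.div_eq_of_lt hi] using this
          have e8 : num z % (2 * q) % q = num y % (2 * q) % q := by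
            rw [e7] at e3; omega
          -- There are only two halves, so two that differ from the uniform one coincide.
          have bit_eq : ∀ {a b t : ℕ}, a < 2 → b < 2 → t < 2 → a ≠ t → b ≠ t → a = b := by omega
          have e9 : num z / (2 * q) = num y / (2 * q) := by omega
          have t1 : num z % (2 * q) / q < 2 :=
            Nat.div_lt_of_lt_mul (by have := Nat.mod_lt (num z) hq2; omega)
          have t2 : num y % (2 * q) / q < 2 :=
            Nat.div_lt_of_lt_mul (by have := Nat.mod_lt (num y) hq2; omega)
          obtain rfl : z = y := by
            have t3 := hs2 x _ hgroup
            rw [e9] at e4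
            refine uniq z e9 ?_
            rw [← Nat.div_add_mod (num z % (2 * q)) q, ← Nat.div_add_mod (num y % (2 * q)) q, e8,
              bit_eq t1 t2 t3 e4 hside]
          exact e5
        · omega
        · omega
      · intro hxy'
        exact Or.inr (Or.inl ⟨by omega, hxy, y, rfl, by omega, by rw [← hr], hside, hxy'⟩)
  · rw [if_neg (by omega), if_pos hr2, zero_mul, one_mul, zero_add,
      htab y x _ ((Nat.mod_lt _ hq2).trans (by omega)), TableBit]
    have hlt := Nat.mod_lt (num x) hq2
    constructor
    · rintro (⟨-, -, z, e1, e2, e3, e4⟩ | H | H | H)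
      · obtain rfl : z = x := by
          apply hnum.inj
          rw [← Nat.div_add_mod (num z) (2 * q), ← Nat.div_add_mod (num x) (2 * q), e3,
            show num z / (2 * q) = num x / (2 * q) by omega]
        exact hC _ _ e4
      all_goals omega
    · intro hxy'
      exact Or.inl ⟨hlt, hxy, x, rfl, by omega, rfl, hC _ _ hxy'⟩

/-- What the decoder computes from correct labels is positive exactly for comparable nodes. -/
theorem comparable_iff (hq : 1 ≤ q) (hC : ∀ x y, C x y → C y x)
    (hnum : IsNumbering C q d num F) (hs2 : ∀ x, ∀ g < num x / (2 * q), s x g < 2)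
    (hs : ∀ x, ∀ g < num x / (2 * q), ∀ y, num y / (2 * q) = g →
      num y % (2 * q) / q = s x g → y ∉ F x → x ∉ F y → (C x y ↔ c x g))
    (htab : ∀ v y o, o < 2 * q + 12 → (0 < bitAt (lab v) (recordPos q M (num y) + o) ↔
      TableBit C q num s c v (num y / (2 * q) / 3) o))
    {x y : Fin n} {a b : ℕ} (ha : 0 < a ↔ y ∈ F x) (hb : 0 < b ↔ x ∈ F y) :
    C x y ↔ 0 < a + b + ((if num y / (2 * q) / 3 < num x / (2 * q) / 3 then 1 else 0) *
        lookupVal q M ((num x / (2 * q) + num y / (2 * q)) % 3) (lab x) (lab y) (num x) (num y) +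
      (if num x / (2 * q) / 3 < num y / (2 * q) / 3 then 1 else 0) *
        lookupVal q M ((num x / (2 * q) + num y / (2 * q)) % 3) (lab y) (lab x)
          (num y) (num x)) := by
  -- Exceptions are always comparable pairs, so whatever the table says about them can only add to a
  -- value that is already positive.
  by_cases h1 : y ∈ F x
  · exact iff_of_true (hnum.comp x y h1) (by have := ha.2 h1; omega)
  by_cases h2 : x ∈ F y
  · exact iff_of_true (hC _ _ (hnum.comp y x h2)) (by have := hb.2 h2; omega)
  have ha0 : a = 0 := by have := mt ha.1 h1; omega
  have hb0 : b = 0 := by have := mt hb.1 h2; omega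
  subst ha0 hb0
  rcases lt_trichotomy (num y / (2 * q) / 3) (num x / (2 * q) / 3) with h | h | h
  · rw [if_pos h, if_neg h.not_gt, one_mul, zero_mul, add_zero, add_zero, zero_add,
      lookupVal_pos_iff hq hC hnum hs2 hs htab h (by rw [add_comm]) h1 h2]
  · rw [h]
    simp only [lt_irrefl, if_false, zero_mul, add_zero, iff_false]
    exact fun hxy => h1 (hnum.triple x y h.symm hxy)
  · rw [if_pos h, if_neg h.not_gt, one_mul, zero_mul, zero_add, zero_add, zero_add,
      lookupVal_pos_iff hq hC hnum hs2 hs htab h rfl h2 h1]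
    exact ⟨hC x y, hC y x⟩

end lookup

end ReachLabel

/-! ### The layout of the labels -/

namespace ReachLabel

/-- A string of length `L`: `p` zeros and a one, fields of width `p` up to position `M`, records of
length `ρ` up to position `B`, and then blocks of length `β`. -/
def mkLabel (p M B L ρ β : ℕ) (f : ℕ → ℕ) (tab exc : ℕ → ℕ → Bool) : List Bool :=
  List.ofFn fun i : Fin L =>
    if (i : ℕ) < p then false
    else if (i : ℕ) = p then true
    else if (i : ℕ) < M then (f ((i - (p + 1)) / p)).testBit ((i - (p + 1)) % p)
    else if (i : ℕ) < B then tab ((i - M) / ρ) ((i - M) % ρ)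
    else exc ((i - B) / β) ((i - B) % β)

section mkLabel

variable {p m M N B L ρ K β : ℕ} {f : ℕ → ℕ} {tab exc : ℕ → ℕ → Bool}

theorem length_mkLabel : (mkLabel p M B L ρ β f tab exc).length = L := by simp [mkLabel]

theorem getD_mkLabel {i : ℕ} (hi : i < L) : (mkLabel p M B L ρ β f tab exc).getD i false =
    if i < p then false
    else if i = p then true
    else if i < M then (f ((i - (p + 1)) / p)).testBit ((i - (p + 1)) % p)
    else if i < B then tab ((i - M) / ρ) ((i - M) % ρ)
    else exc ((i - B) / β) ((i - B) % β) := by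
  rw [List.getD_eq_getElem _ _ (by rwa [length_mkLabel])]
  simp [mkLabel]

theorem hasFields_mkLabel (hM : M = p + 1 + p * m) (hL : M ≤ L) (hf : ∀ k, f k < 2 ^ p) :
    HasFields p m f (mkLabel p M B L ρ β f tab exc) where
  zero i hi := by rw [getD_mkLabel (by omega), if_pos hi]
  one := by rw [getD_mkLabel (by omega), if_neg (by omega), if_pos rfl]
  field k hk j hj := by
    have h1 : p * k + p ≤ p * m := by
      rw [← mul_add_one]; exact Nat.mul_le_mul_left _ hk
    rw [getD_mkLabel (by omega), if_neg (by omega), if_neg (by omega), if_pos (by omega)]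
    have e : p + 1 + p * k + j - (p + 1) = p * k + j := by omega
    rw [e, Nat.mul_add_div (by omega), Nat.div_eq_of_lt hj, Nat.mul_add_mod, Nat.mod_eq_of_lt hj,
      add_zero]
  lt := hf

theorem getD_mkLabel_table (hM : p < M) (hB : B = M + N * ρ) (hL : B ≤ L) {T o : ℕ} (hT : T < N)
    (ho : o < ρ) : (mkLabel p M B L ρ β f tab exc).getD (M + T * ρ + o) false = tab T o := by
  have h1 : T * ρ + ρ ≤ N * ρ := by
    rw [← add_one_mul]; exact Nat.mul_le_mul_right _ hT
  rw [getD_mkLabel (by omega), if_neg (by omega), if_neg (by omega), if_neg (by omega),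
    if_pos (by omega)]
  have e : M + T * ρ + o - M = ρ * T + o := by rw [mul_comm ρ]; omega
  rw [e, Nat.mul_add_div (by omega), Nat.div_eq_of_lt ho, Nat.mul_add_mod, Nat.mod_eq_of_lt ho,
    add_zero]

theorem getD_mkLabel_block (hM : p < M) (hB : M ≤ B) (hL : L = B + K * β) {k o : ℕ} (hk : k < K)
    (ho : o < β) : (mkLabel p M B L ρ β f tab exc).getD (B + k * β + o) false = exc k o := by
  have h1 : k * β + β ≤ K * β := by
    rw [← add_one_mul]; exact Nat.mul_le_mul_right _ hk
  rw [getD_mkLabel (by omega), if_neg (by omega), if_neg (by omega), if_neg (by omega),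
    if_neg (by omega)]
  have e : B + k * β + o - B = β * k + o := by rw [mul_comm β]; omega
  rw [e, Nat.mul_add_div (by omega), Nat.div_eq_of_lt ho, Nat.mul_add_mod, Nat.mod_eq_of_lt ho,
    add_zero]

end mkLabel

-- Ranks are slots for bitmap blocks. Blocks with an exception get slots of their own; all others
-- share the slot `J.card`, whose content is zero.
open Classical in
theorem exists_ranking (J : Finset ℕ) :
    ∃ r : ℕ → ℕ, (∀ j, r j ≤ J.card) ∧ ∀ j ∈ J, ∀ k, r j = r k → j = k := by
  refine ⟨fun j => if h : j ∈ J then J.equivFin ⟨j, h⟩ else J.card, fun j => ?_, fun j hj k h => ?_⟩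
  · by_cases h : j ∈ J
    · simp [h]
    · simp [h]
  · have := (J.equivFin ⟨j, hj⟩).2
    by_cases hk : k ∈ J
    · simp only [hj, hk, dite_true] at h
      simpa using J.equivFin.injective (Fin.ext h)
    · simp only [hj, hk, dite_true, dite_false] at h
      omega

/-- The fields of the label of a node. -/
def fieldValue (p q M B : ℕ) (height num : ℕ) (r : ℕ → ℕ) : ℕ → ℕ
  | 0 => p
  | 1 => q
  | 2 => height
  | 3 => num
  | 4 => M
  | k + 5 => B + r k * (p * p)

open Classical WordRAM in
/-- Labels for a graph with numbered nodes. -/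
theorem exists_labels {n : ℕ} (G : Digraph (Fin n)) {q d p : ℕ} (hq : 1 ≤ q) (hp : 16 ≤ p)
    {num : Fin n → ℕ} {F : Fin n → Finset (Fin n)} (hnum : IsNumbering G.Comparable q d num F)
    (hbig : p + 1 + p * (n / (p * p) + 6) + (n / (2 * q) / 3 + 1) * (2 * q + 12) +
      (n / (p * p) + 2) * (p * p) < 2 ^ p) :
    ∃ lab : Fin n → List Bool, Function.Injective lab ∧
      (∀ v, (lab v).length ≤ p + 1 + p * (n / (p * p) + 6) +
        (n / (2 * q) / 3 + 1) * (2 * q + 12) + (d + 1) * (p * p)) ∧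
      ∀ w, 8 * p ≤ w → ∀ u v, DecidesWithin Expr.decoder.program w (lab u) (lab v)
        Expr.decoder.program.length (G.Reaches u v) := by
  have hpp : 0 < p * p := by positivity
  have hhalf := hnum.half
  choose! s c hs2 hs using hhalf
  set m := n / (p * p) + 6 with hm
  set M := p + 1 + p * m with hM
  set N := n / (2 * q) / 3 + 1 with hN
  set B := M + N * (2 * q + 12) with hB
  let J : Fin n → Finset ℕ := fun v => (F v).image fun y => num y / (p * p)
  have hJd : ∀ v, (J v).card ≤ d := fun v => Finset.card_image_le.trans (hnum.card_le v)
  have hJn : ∀ v, (J v).card ≤ n / (p * p) + 1 := fun v => by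
    refine (Finset.card_le_card (t := Finset.range (n / (p * p) + 1)) fun j hj => ?_).trans
      (by simp)
    obtain ⟨y, -, rfl⟩ := Finset.mem_image.1 hj
    rw [Finset.mem_range, Nat.lt_succ_iff]
    exact Nat.div_le_div_right (hnum.lt y).le
  choose r hr hrinj using fun v => exists_ranking (J v)
  let f : Fin n → ℕ → ℕ := fun v => fieldValue p q M B (G.height v) (num v) (r v)
  let L : Fin n → ℕ := fun v => B + ((J v).card + 1) * (p * p)
  let tab : Fin n → ℕ → ℕ → Bool := fun v T o =>
    decide (TableBit G.Comparable q num s c v T o)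
  let exc : Fin n → ℕ → ℕ → Bool := fun v k o =>
    decide (∃ y ∈ F v, r v (num y / (p * p)) = k ∧ num y % (p * p) = o)
  let lab : Fin n → List Bool := fun v =>
    mkLabel p M B (L v) (2 * q + 12) (p * p) (f v) (tab v) (exc v)
  have hn : n < (n / (p * p) + 2) * (p * p) := by
    have h1 := Nat.div_add_mod n (p * p)
    have h2 := Nat.mod_lt n hpp
    rw [add_mul, mul_comm]; omega
  have hNq : 2 * q + 12 ≤ N * (2 * q + 12) := Nat.le_mul_of_pos_left _ (Nat.succ_pos _)
  have h3m : 3 < m := lt_of_lt_of_le (by norm_num) (Nat.le_add_left 6 _)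
  have hf : ∀ v k, f v k < 2 ^ p := by
    intro v k
    have h1 := G.height_le_card v
    have h2 := hnum.lt v
    match k with
    | 0 => simp only [f, fieldValue]; omega
    | 1 => simp only [f, fieldValue]; omega
    | 2 => simp only [f, fieldValue]; omega
    | 3 => simp only [f, fieldValue]; omega
    | 4 => simp only [f, fieldValue]; omega
    | k + 5 =>
      have h3 : r v k * (p * p) ≤ (n / (p * p) + 2) * (p * p) :=
        Nat.mul_le_mul_right _ (by have := hr v k; have := hJn v; omega)
      simp only [f, fieldValue]; omega
  have hfields : ∀ v, HasFields p m (f v) (lab v) := fun v =>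
    hasFields_mkLabel hM (by simp only [L]; omega) (hf v)
  have htab : ∀ v y o, o < 2 * q + 12 → (0 < bitAt (lab v) (recordPos q M (num y) + o) ↔
      TableBit G.Comparable q num s c v (num y / (2 * q) / 3) o) := by
    intro v y o ho
    have hT : num y / (2 * q) / 3 < N :=
      Nat.lt_succ_of_le (Nat.div_le_div_right (Nat.div_le_div_right (hnum.lt y).le))
    have := getD_mkLabel_table (β := p * p) (f := f v) (tab := tab v) (exc := exc v)
      (show p < M by omega) hB (show B ≤ L v by simp only [L]; omega) hT ho
    rw [bitAt, recordPos, this]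
    simp only [tab]
    by_cases h : TableBit G.Comparable q num s c v (num y / (2 * q) / 3) o <;> simp [h]
  have hexc : ∀ v y, 0 < bitAt (lab v) (f v (5 + num y / (p * p)) + num y % (p * p)) ↔
      y ∈ F v := by
    intro v y
    have h5 : f v (5 + num y / (p * p)) = B + r v (num y / (p * p)) * (p * p) := by
      rw [add_comm]; rfl
    have := getD_mkLabel_block (ρ := 2 * q + 12) (f := f v) (tab := tab v) (exc := exc v)
      (show p < M by omega) (show M ≤ B by omega) (show L v = _ from rfl)
      (Nat.lt_succ_of_le (hr v (num y / (p * p)))) (Nat.mod_lt (num y) hpp)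
    rw [h5, bitAt, this]
    have hiff : (∃ z ∈ F v, r v (num z / (p * p)) = r v (num y / (p * p)) ∧
        num z % (p * p) = num y % (p * p)) ↔ y ∈ F v := by
      refine ⟨?_, fun h => ⟨y, h, rfl, rfl⟩⟩
      rintro ⟨z, hz, h1, h2⟩
      have h3 := hrinj v _ (Finset.mem_image_of_mem _ hz) _ h1
      obtain rfl : z = y := hnum.inj (by
        rw [← Nat.div_add_mod (num z) (p * p), ← Nat.div_add_mod (num y) (p * p), h2, h3])
      exact hz
    simp only [exc, hiff]
    by_cases h : y ∈ F v <;> simp [h]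
  refine ⟨lab, fun u v huv => hnum.inj ?_, fun v => ?_, fun w hw u v => ?_⟩
  -- Field 3 holds the number of the node, which makes the labels distinct.
  · have : f u 3 = f v 3 := by
      apply Nat.eq_of_testBit_eq
      intro j
      by_cases hj : j < p
      · rw [← (hfields u).field 3 h3m j hj, ← (hfields v).field 3 h3m j hj, huv]
      · have hpj := Nat.pow_le_pow_right two_pos (not_lt.1 hj)
        rw [Nat.testBit_lt_two_pow ((hf u 3).trans_le hpj),
          Nat.testBit_lt_two_pow ((hf v 3).trans_le hpj)]
    exact this
  · simp only [lab, length_mkLabel, L]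
    have : ((J v).card + 1) * (p * p) ≤ (d + 1) * (p * p) :=
      Nat.mul_le_mul_right _ (by have := hJd v; omega)
    omega
  · have H : Expr.Decodable w p q M m (lab u) (lab v)
        (fun X => f (match X with | .source => u | .target => v)) := by
      refine ⟨fun X => ?_, fun X => rfl, fun X => rfl, fun X => rfl, fun X => ?_, hp, hq, hw⟩
      · cases X
        · exact hfields u
        · exact hfields v
      · have : ∀ y : Fin n, 5 + num y / (p * p) < m := fun y => by
          have := Nat.div_le_div_right (c := p * p) (hnum.lt y).le
          omega
        cases X
        · exact this u
        · exact this v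
    have hC := comparable_iff hq (fun x y h => h.symm) hnum hs2 hs htab (hexc u v) (hexc v u)
    have hdec := H.decoder hC
    have hreach := G.reaches_iff u v
    refine Expr.decidesWithin_program _ (fun h => hdec.1 (hreach.1 h)) fun h => hdec.2 fun h' => ?_
    exact h (hreach.2 h')

end ReachLabel

/-! ### Choice of the parameters and asymptotics -/

namespace ReachLabel

/-- The field width for graphs on `n` nodes. -/
def fieldWidth (n : ℕ) : ℕ := 16 * (Nat.log 2 n + 1)

/-- Half of the group size for graphs on `n` nodes. -/
def halfSize (n : ℕ) : ℕ :=
  Nat.findGreatest (fun k => (k + 1) * fieldWidth n ^ (6 * (k + 1)) < n) n + 1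

/-- A bound for the number of neighbours in relations without large complete bipartite parts. -/
def sparsity (n : ℕ) : ℕ :=
  if halfSize n * fieldWidth n ^ (6 * halfSize n) < n then n / fieldWidth n ^ 6 + 1
  else n + halfSize n + 1

/-- The number of nodes on a level. -/
def levelSize (n : ℕ) : ℕ := n / fieldWidth n ^ 3 + 1

/-- A bound for the number of exceptions stored in a label. -/
def exceptionBound (n : ℕ) : ℕ :=
  n / levelSize n * (sparsity n + halfSize n) + levelSize n + 6 * halfSize n

/-- A bound for the length of the labels. -/
def labelLength (n : ℕ) : ℕ :=
  fieldWidth n + 1 + fieldWidth n * (n / (fieldWidth n * fieldWidth n) + 6) +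
    (n / (2 * halfSize n) / 3 + 1) * (2 * halfSize n + 12) +
    (exceptionBound n + 1) * (fieldWidth n * fieldWidth n)

theorem le_fieldWidth (n : ℕ) : 16 ≤ fieldWidth n := by unfold fieldWidth; omega

theorem one_le_halfSize (n : ℕ) : 1 ≤ halfSize n := Nat.le_add_left _ _

theorem halfSize_le (n : ℕ) : halfSize n ≤ n + 1 :=
  Nat.succ_le_succ (Nat.findGreatest_le n)

/-- With δ ≥ n/p⁶ one has δ^q · p^(6q) ≥ n^q, and q · p^(6q) < n gives the claim. Where the latter
fails, a value of δ exceeding both n and q suffices. -/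
theorem mul_pow_lt_sparsity_pow (n : ℕ) :
    halfSize n * n ^ (halfSize n - 1) < sparsity n ^ halfSize n := by
  obtain ⟨k, hk⟩ := Nat.exists_eq_add_of_le' (one_le_halfSize n)
  unfold sparsity
  have hp : 0 < fieldWidth n := by have := le_fieldWidth n; omega
  rw [hk, Nat.add_sub_cancel]
  set p := fieldWidth n
  split_ifs with h
  · have hn : 0 < n := by omega
    have h1 : n ≤ (n / p ^ 6 + 1) * p ^ 6 := by
      have := Nat.div_add_mod n (p ^ 6)
      have := Nat.mod_lt n (show p ^ 6 > 0 by positivity)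
      rw [add_mul, mul_comm]; omega
    refine Nat.lt_of_mul_lt_mul_right (a := p ^ (6 * (k + 1))) ?_
    calc (k + 1) * n ^ k * p ^ (6 * (k + 1)) = n ^ k * ((k + 1) * p ^ (6 * (k + 1))) := by ring
      _ < n ^ k * n := Nat.mul_lt_mul_of_pos_left h (by positivity)
      _ = n ^ (k + 1) := (pow_succ _ _).symm
      _ ≤ ((n / p ^ 6 + 1) * p ^ 6) ^ (k + 1) := Nat.pow_le_pow_left h1 _
      _ = _ := by rw [mul_pow, ← pow_mul]
  · calc (k + 1) * n ^ k ≤ (k + 1) * (n + (k + 1) + 1) ^ k :=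
          Nat.mul_le_mul_left _ (Nat.pow_le_pow_left (by omega) _)
      _ < (n + (k + 1) + 1) * (n + (k + 1) + 1) ^ k :=
          Nat.mul_lt_mul_of_pos_right (by omega) (by positivity)
      _ = _ := by ring

/-- All positions in a label must fit into a field. With Z = 2^(⌊log₂ n⌋ + 1) > n every term is
O(Z²), whereas the right-hand side is Z^16. -/
theorem lt_two_pow_fieldWidth (n : ℕ) :
    fieldWidth n + 1 + fieldWidth n * (n / (fieldWidth n * fieldWidth n) + 6) +
      (n / (2 * halfSize n) / 3 + 1) * (2 * halfSize n + 12) +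
      (n / (fieldWidth n * fieldWidth n) + 2) * (fieldWidth n * fieldWidth n) <
      2 ^ fieldWidth n := by
  set l := Nat.log 2 n + 1 with hl
  set Z := 2 ^ l with hZ
  have hn : n + 1 ≤ Z := Nat.lt_pow_succ_log_self one_lt_two n
  have hlZ : l ≤ Z := Nat.lt_two_pow_self.le
  have hZ2 : 2 ≤ Z := by
    calc 2 = 2 ^ 1 := rfl
      _ ≤ 2 ^ l := Nat.pow_le_pow_right two_pos (by omega)
  have hp : fieldWidth n = 16 * l := rfl
  have hpow : 2 ^ fieldWidth n = Z ^ 16 := by rw [hp, hZ, ← pow_mul, mul_comm]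
  have hpZ : fieldWidth n ≤ 16 * Z := by omega
  rw [hpow]
  set p := fieldWidth n
  have h1 : p * (n / (p * p) + 6) ≤ 16 * Z * (Z + 6) :=
    Nat.mul_le_mul hpZ (by have := Nat.div_le_self n (p * p); omega)
  have h2 : (n / (2 * halfSize n) / 3 + 1) * (2 * halfSize n + 12) ≤ Z * (2 * Z + 12) := by
    refine Nat.mul_le_mul ?_ (by have := halfSize_le n; omega)
    have := (Nat.div_le_self (n / (2 * halfSize n)) 3).trans (Nat.div_le_self _ _)
    omega
  have h3 : (n / (p * p) + 2) * (p * p) ≤ Z + 2 * (16 * Z * (16 * Z)) := by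
    rw [add_mul]
    have := Nat.div_mul_le_self n (p * p)
    have := Nat.mul_le_mul hpZ hpZ
    omega
  have h4 : 1024 * Z ^ 2 ≤ Z ^ 16 := by
    calc 1024 * Z ^ 2 = 2 ^ 10 * Z ^ 2 := by norm_num
      _ ≤ Z ^ 10 * Z ^ 2 := Nat.mul_le_mul_right _ (Nat.pow_le_pow_left hZ2 _)
      _ = Z ^ 12 := by ring
      _ ≤ Z ^ 16 := Nat.pow_le_pow_right (by omega) (by norm_num)
  have h5 : 2 * Z ≤ Z ^ 2 := by rw [sq]; exact Nat.mul_le_mul_right _ hZ2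
  have h6 : 16 * Z * (Z + 6) = 16 * Z ^ 2 + 96 * Z := by ring
  have h7 : Z * (2 * Z + 12) = 2 * Z ^ 2 + 12 * Z := by ring
  have h8 : 2 * (16 * Z * (16 * Z)) = 512 * Z ^ 2 := by ring
  omega

theorem isLittleO_fieldWidth_pow (k : ℕ) :
    (fun n : ℕ => (fieldWidth n : ℝ) ^ k) =o[atTop] fun n : ℕ => (n : ℝ) := by
  have h1 : (fun n : ℕ => (fieldWidth n : ℝ)) =O[atTop] fun n : ℕ => Real.log n := by
    refine IsBigO.of_bound 64 ?_
    filter_upwards [eventually_ge_atTop 3] with n hn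
    have hlog : 1 ≤ Real.log n := by
      rw [Real.le_log_iff_exp_le (by positivity)]
      have : (3 : ℝ) ≤ n := by exact_mod_cast hn
      linarith [Real.exp_one_lt_d9]
    have h2 : (Nat.log 2 n : ℝ) ≤ 2 * Real.log n := by
      refine (Real.natLog_le_logb n 2).trans ?_
      rw [Real.logb, div_le_iff₀ (Real.log_pos (by norm_num))]
      have := Real.log_two_gt_d9
      push_cast
      nlinarith
    rw [Real.norm_of_nonneg (by positivity), Real.norm_of_nonneg (by linarith), fieldWidth]
    push_cast
    linarith
  exact (h1.pow k).trans_isLittleO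
    ((Real.isLittleO_pow_log_id_atTop (n := k)).comp_tendsto tendsto_natCast_atTop_atTop)

theorem eventually_mul_fieldWidth_pow_lt (k : ℕ) :
    ∀ᶠ n : ℕ in atTop, (k + 1) * fieldWidth n ^ (6 * (k + 1)) < n := by
  have h := (isLittleO_fieldWidth_pow (6 * (k + 1))).def
    (show (0 : ℝ) < 1 / (2 * (k + 1)) by positivity)
  filter_upwards [h, eventually_gt_atTop 0] with n hn hpos
  rw [Real.norm_of_nonneg (by positivity), Real.norm_of_nonneg (by positivity), div_mul_eq_mul_div,
    le_div_iff₀ (by positivity)] at hn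
  have hpos' : (0 : ℝ) < n := by exact_mod_cast hpos
  have : ((k + 1) * fieldWidth n ^ (6 * (k + 1)) : ℝ) < n := by linarith
  exact_mod_cast this

/-- For fixed `k` the defining condition compares a power of log n with n, so it holds eventually.
-/
theorem tendsto_halfSize : Tendsto halfSize atTop atTop := by
  refine tendsto_atTop.2 fun k => ?_
  filter_upwards [eventually_mul_fieldWidth_pow_lt k, eventually_ge_atTop k] with n hn hk
  exact (Nat.le_findGreatest (P := fun k => (k + 1) * fieldWidth n ^ (6 * (k + 1)) < n) hk hn).trans
    (Nat.le_succ _)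

/-- `Nat.findGreatest` satisfies its predicate only if some candidate does; eventually 0 is one. -/
theorem eventually_halfSize_mul_lt :
    ∀ᶠ n : ℕ in atTop, halfSize n * fieldWidth n ^ (6 * halfSize n) < n := by
  filter_upwards [eventually_mul_fieldWidth_pow_lt 0] with n hn
  exact Nat.findGreatest_spec (P := fun k => (k + 1) * fieldWidth n ^ (6 * (k + 1)) < n)
    (Nat.zero_le n) hn

/-- About n/(6q) records of length 2q + 12 give n/3 + 2n/q, and the pointers about n/p. Up to
rounding, p³ merges with n/p⁶ exceptions each and n/p³ from the level, at p² bits apiece, also give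
O(n/p); q · p⁶ ≤ n controls the terms containing q. -/
theorem labelLength_le {n : ℕ} (h : halfSize n * fieldWidth n ^ (6 * halfSize n) < n) :
    (labelLength n : ℝ) ≤ n / 3 + (2 * (n / halfSize n) + 20 * (n / fieldWidth n) +
      20 * fieldWidth n ^ 5) := by
  have hp16 := le_fieldWidth n
  have hq1 := one_le_halfSize n
  have hs : sparsity n = n / fieldWidth n ^ 6 + 1 := if_pos h
  unfold labelLength exceptionBound levelSize
  rw [hs]
  set p := fieldWidth n
  set q := halfSize n
  have hqp : q * p ^ 6 ≤ n := by
    refine le_trans (Nat.mul_le_mul_left _ (Nat.pow_le_pow_right (by omega) ?_)) h.le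
    omega
  have hP : (16 : ℝ) ≤ p := by exact_mod_cast hp16
  have hQ : (1 : ℝ) ≤ q := by exact_mod_cast hq1
  have hQP : (q : ℝ) * p ^ 6 ≤ n := by exact_mod_cast hqp
  have hp0 : (0 : ℝ) < p := by linarith
  have hq0 : (0 : ℝ) < q := by linarith
  set X : ℝ := n / p with hX
  have hnX : (n : ℝ) = X * p := by rw [hX]; field_simp
  have hX0 : 0 ≤ X := by positivity
  have t1 : (p : ℝ) * ((n / (p * p) : ℕ) : ℝ) ≤ X := by
    have : ((n / (p * p) : ℕ) : ℝ) ≤ n / (p * p) := by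
      simpa using (Nat.cast_div_le (α := ℝ) (m := n) (n := p * p))
    calc (p : ℝ) * ((n / (p * p) : ℕ) : ℝ) ≤ p * (n / (p * p)) := by gcongr
      _ = X := by rw [hX]; field_simp
  have t2 : ((n / (2 * q) / 3 : ℕ) : ℝ) * (2 * q + 12) ≤ n / 3 + 2 * (n / q) := by
    have : ((n / (2 * q) / 3 : ℕ) : ℝ) ≤ n / (2 * q * 3) := by
      rw [Nat.div_div_eq_div_mul]
      simpa using (Nat.cast_div_le (α := ℝ) (m := n) (n := 2 * q * 3))
    calc ((n / (2 * q) / 3 : ℕ) : ℝ) * (2 * q + 12) ≤ n / (2 * q * 3) * (2 * q + 12) := by gcongr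
      _ = n / 3 + 2 * (n / q) := by field_simp; ring
  have hqX : (q : ℝ) * p ^ 5 ≤ X := by
    rw [hX, le_div_iff₀ hp0]; linarith [hQP, show (q : ℝ) * p ^ 5 * p = q * p ^ 6 by ring]
  have hqX' : (q : ℝ) * p ^ 2 ≤ X := hqX.trans' (by gcongr <;> [linarith; norm_num])
  have hqX0 : (q : ℝ) ≤ X := hqX'.trans' (le_mul_of_one_le_right hq0.le (one_le_pow₀ (by linarith)))
  have t3 : ((n / (n / p ^ 3 + 1) : ℕ) : ℝ) ≤ p ^ 3 := by
    have : n / (n / p ^ 3 + 1) ≤ p ^ 3 := by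
      refine Nat.div_le_of_le_mul ?_
      have h1 := Nat.div_add_mod n (p ^ 3)
      have h2 := Nat.mod_lt n (show p ^ 3 > 0 by positivity)
      rw [add_mul, mul_comm]; omega
    exact_mod_cast this
  have t4 : ((n / p ^ 6 : ℕ) : ℝ) * p ^ 5 ≤ X := by
    have : ((n / p ^ 6 : ℕ) : ℝ) ≤ n / p ^ 6 := by
      exact_mod_cast Nat.cast_div_le (α := ℝ) (m := n) (n := p ^ 6)
    calc ((n / p ^ 6 : ℕ) : ℝ) * p ^ 5 ≤ n / p ^ 6 * p ^ 5 := by gcongr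
      _ = X := by rw [hX]; field_simp
  have t5 : ((n / p ^ 3 : ℕ) : ℝ) * (p * p) ≤ X := by
    have : ((n / p ^ 3 : ℕ) : ℝ) ≤ n / p ^ 3 := by
      exact_mod_cast Nat.cast_div_le (α := ℝ) (m := n) (n := p ^ 3)
    calc ((n / p ^ 3 : ℕ) : ℝ) * (p * p) ≤ n / p ^ 3 * (p * p) := by gcongr
      _ = X := by rw [hX]; field_simp
  have t6 : ((n / (n / p ^ 3 + 1) : ℕ) : ℝ) * ((n / p ^ 6 : ℕ) + 1 + q) * (p * p) ≤
      2 * X + p ^ 5 := by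
    calc _ ≤ (p : ℝ) ^ 3 * ((n / p ^ 6 : ℕ) + 1 + q) * (p * p) := by gcongr
      _ = ((n / p ^ 6 : ℕ) : ℝ) * p ^ 5 + p ^ 5 + q * p ^ 5 := by ring
      _ ≤ _ := by linarith
  have p5 : (p : ℝ) ≤ p ^ 5 := le_self_pow₀ (by linarith) (by norm_num)
  have p25 : (p : ℝ) * p ≤ p ^ 5 := by
    rw [← sq]; exact pow_le_pow_right₀ (by linarith) (by norm_num)
  have p05 : (16 : ℝ) ≤ p ^ 5 := hP.trans p5
  push_cast
  nlinarith

/-- Truncation at 0 lets an upper bound on the label length control the norm. -/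
theorem isLittleO_labelLength :
    (fun n : ℕ => max 0 ((labelLength n : ℝ) - n / 3)) =o[atTop] fun n : ℕ => (n : ℝ) := by
  have hdiv : ∀ f : ℕ → ℕ, Tendsto f atTop atTop →
      (fun n : ℕ => (n : ℝ) / f n) =o[atTop] fun n : ℕ => (n : ℝ) := by
    intro f hf
    have h1 : Tendsto (fun n : ℕ => ((f n : ℝ))⁻¹) atTop (nhds 0) :=
      tendsto_inv_atTop_zero.comp (tendsto_natCast_atTop_atTop.comp hf)
    have := (isBigO_refl (fun n : ℕ => (n : ℝ)) atTop).mul_isLittleO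
      ((isLittleO_one_iff ℝ).2 h1)
    simpa [div_eq_mul_inv] using this
  have hwidth : Tendsto fieldWidth atTop atTop := by
    refine tendsto_atTop.2 fun k => ?_
    filter_upwards [eventually_ge_atTop (2 ^ k)] with n hn
    have := Nat.le_log_of_pow_le one_lt_two hn
    unfold fieldWidth
    omega
  have hsum : (fun n : ℕ => 2 * ((n : ℝ) / halfSize n) + 20 * (n / fieldWidth n) +
      20 * (fieldWidth n : ℝ) ^ 5) =o[atTop] fun n : ℕ => (n : ℝ) :=
    (((hdiv _ tendsto_halfSize).const_mul_left 2).add ((hdiv _ hwidth).const_mul_left 20)).add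
      ((isLittleO_fieldWidth_pow 5).const_mul_left 20)
  refine IsBigO.trans_isLittleO (IsBigO.of_bound 1 ?_) hsum
  filter_upwards [eventually_halfSize_mul_lt] with n hn
  have h1 := labelLength_le hn
  rw [Real.norm_of_nonneg (le_max_left _ _), Real.norm_of_nonneg (by positivity), one_mul]
  exact max_le (by positivity) (by linarith)

end ReachLabel

theorem mainTheorem1 :
    ∃ (enc : LabelEncoder) (dec : WordRAM.Program) (c T : ℕ) (ε : ℕ → ℝ),
      IsReachabilityScheme enc dec c T ∧
      ε =o[atTop] (fun n : ℕ => (n : ℝ)) ∧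
      ∀ (n : ℕ) (G : Digraph (Fin n)) (u : Fin n),
        ((enc n G u).length : ℝ) ≤ (n : ℝ) / 3 + ε n := by
  have key : ∀ (n : ℕ) (G : Digraph (Fin n)), ∃ lab : Fin n → List Bool, Function.Injective lab ∧
      (∀ v, (lab v).length ≤ ReachLabel.labelLength n) ∧
      ∀ w, 8 * ReachLabel.fieldWidth n ≤ w → ∀ u v,
        WordRAM.DecidesWithin WordRAM.Expr.decoder.program w (lab u) (lab v)
          WordRAM.Expr.decoder.program.length (G.Reaches u v) := by
    intro n G
    obtain ⟨num, F, hnum⟩ := ReachLabel.exists_isNumbering G (ReachLabel.one_le_halfSize n)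
      (Nat.le_add_left 1 _ : 1 ≤ ReachLabel.levelSize n) (ReachLabel.mul_pow_lt_sparsity_pow n)
    exact ReachLabel.exists_labels G (ReachLabel.one_le_halfSize n) (ReachLabel.le_fieldWidth n)
      hnum (ReachLabel.lt_two_pow_fieldWidth n)
  choose enc hinj hlen hdec using key
  -- The decoder needs words of 8 field widths of 16 (⌊log₂ n⌋ + 1) bits each, whence 128.
  refine ⟨enc, WordRAM.Expr.decoder.program, 128, WordRAM.Expr.decoder.program.length, _,
    fun n G => ⟨hinj n G, fun w hw => hdec n G w ?_⟩, ReachLabel.isLittleO_labelLength,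
    fun n G u => ?_⟩
  · unfold ReachLabel.fieldWidth; omega
  · have h1 : ((enc n G u).length : ℝ) ≤ ReachLabel.labelLength n := by
      exact_mod_cast hlen n G u
    have h2 := le_max_right 0 ((ReachLabel.labelLength n : ℝ) - n / 3)
    linarith
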